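/- \textbf{Model.} Let $\kappa(x,y)=c_0/(|x-y|^{\Delta}+c_1)$ on $[0,1]^2$, with constants $0<c_0\le c_1$ and $\Delta>1$ (so $\kappa$ takes values in $(0,1]$), and let $\mathcal D$ be a probability distribution on $[0,1]$ with cdf $F$. For integers $n,m$ let $x_1,\dots,x_n$ (influencers) and $y_1,\dots,y_m$ (followers) be i.i.d. with law $\mathcal D$. Given these positions, let $B\in\{0,1\}^{m\times n}$ have independent entries with $\Pr[B_{j,i}=1]=\kappa(y_j,x_i)/n$. Let $A$ be $B^{\mathsf T}B$ with its diagonal entries set to $0$, and let $M\in\mathbb R^{n\times n}$ have entries $M_{i,i'}=\mu(x_i,x_{i'})$, where $\mu(x,x')=\int\kappa(x,z)\kappa(z,x')\,dF(z)$. Let $\|\cdot\|$ be the spectral norm. \textbf{Lemma.} There is an absolute constant $c'>0$ with the following property. For all $c_0,c_1,\Delta,\mathcal D$ as above there is a constant $C>0$ such that, for every $c\ge c'$ and every sequence $m=m(n)$ of natural numbers with $m=\Omega(n\log^{c}n)$ and $m=O(n\log^{k}n)$ for some constant $k$, we have $$\left\|\frac nm A-\frac1n M\right\|\le C\left(\frac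 nm\right)^{1/4}$$ with high probability, i.e., for every real $a$ and all sufficiently large $n$ (depending on $a$, the model and the sequence $m$) this inequality holds with probability larger than $1-n^{-a}$. -/

import Mathlib

open MeasureTheory ProbabilityTheory unitInterval
open scoped Asymptotics

namespace BipartiteModel

/-- The small-world kernel `κ(x, y) = c₀ / (|x - y| ^ Δ + c₁)` on `[0, 1]`. For `0 < c₀ ≤ c₁`
and `Δ > 1` it takes its values in `(0, 1]`. -/
noncomputable def kernel (c₀ c₁ Δ : ℝ) (x y : I) : ℝ :=
  c₀ / (|(x : ℝ) - (y : ℝ)| ^ Δ + c₁)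

/-- The square kernel `μ(x, x') = ∫ κ(x, z) κ(z, x') dF(z)`. -/
noncomputable def sqKernel (c₀ c₁ Δ : ℝ) (D : Measure I) (x x' : I) : ℝ :=
  ∫ z, kernel c₀ c₁ Δ x z * kernel c₀ c₁ Δ z x' ∂D

/-- The probability `κ(y, x) / n` that a follower at `y` interacts with an influencer at `x`,
as an element of `[0, 1]`. The projection to `[0, 1]` does nothing when `κ` has values in
`(0, 1]`, see `coe_edgeProb`. -/
noncomputable def edgeProb (c₀ c₁ Δ : ℝ) (n : ℕ) (y x : I) : I :=
  Set.projIcc 0 1 zero_le_one (kernel c₀ c₁ Δ y x / n)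

lemma kernel_mem (c₀ c₁ Δ : ℝ) (h₀ : 0 < c₀) (h₁ : c₀ ≤ c₁) (x y : I) :
    kernel c₀ c₁ Δ x y ∈ Set.Ioc (0 : ℝ) 1 := by
  have h : 0 ≤ |(x : ℝ) - (y : ℝ)| ^ Δ := by positivity
  have hp : 0 < |(x : ℝ) - (y : ℝ)| ^ Δ + c₁ := by linarith
  refine ⟨div_pos h₀ hp, ?_⟩
  rw [kernel, div_le_one hp]
  linarith

lemma coe_edgeProb (c₀ c₁ Δ : ℝ) (h₀ : 0 < c₀) (h₁ : c₀ ≤ c₁) (n : ℕ) (y x : I) :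
    (edgeProb c₀ c₁ Δ n y x : ℝ) = kernel c₀ c₁ Δ y x / n := by
  have hk := kernel_mem c₀ c₁ Δ h₀ h₁ y x
  have hmem : kernel c₀ c₁ Δ y x / n ∈ Set.Icc (0 : ℝ) 1 := by
    refine ⟨div_nonneg hk.1.le n.cast_nonneg, ?_⟩
    rcases Nat.eq_zero_or_pos n with rfl | hn
    · simp
    · exact div_le_one_of_le₀ (hk.2.trans (by exact_mod_cast hn)) n.cast_nonneg
  simp [edgeProb, Set.projIcc_of_mem zero_le_one hmem]

lemma measurable_edgeProb (c₀ c₁ Δ : ℝ) (n : ℕ) :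
    Measurable (fun p : I × I => edgeProb c₀ c₁ Δ n p.1 p.2) := by
  unfold edgeProb kernel
  refine continuous_projIcc.measurable.comp ?_
  fun_prop

/-- Given the latent positions `x` of the influencers and `y` of the followers, the edges are
independent, and the edge between follower `j` and influencer `i` is present (`true`) with
probability `κ(y_j, x_i) / n`. -/
noncomputable def edgeMeasure (c₀ c₁ Δ : ℝ) (n m : ℕ) (p : (Fin n → I) × (Fin m → I)) :
    Measure (Fin m → Fin n → Bool) :=
  Measure.pi fun j => Measure.pi fun i =>
    bernoulliMeasure true false (edgeProb c₀ c₁ Δ n (p.2 j) (p.1 i))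

instance (c₀ c₁ Δ : ℝ) (n m : ℕ) (p : (Fin n → I) × (Fin m → I)) :
    IsProbabilityMeasure (edgeMeasure c₀ c₁ Δ n m p) := by
  unfold edgeMeasure
  infer_instance

lemma measurable_bernoulliMeasure_singleton (b : Bool) :
    Measurable fun q : I => bernoulliMeasure true false q {b} := by
  have ht : Measurable (toNNReal : I → NNReal) := measurable_subtype_coe.subtype_mk
  have hs : Measurable (fun q : I => toNNReal (σ q)) :=
    ht.comp continuous_symm.measurable
  simp only [bernoulliMeasure_def, Measure.add_apply, Measure.smul_apply]
  exact ((ht.coe_nnreal_ennreal.mul_const _).add (hs.coe_nnreal_ennreal.mul_const _))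

lemma measurable_edgeMeasure (c₀ c₁ Δ : ℝ) (n m : ℕ) :
    Measurable (edgeMeasure c₀ c₁ Δ n m) := by
  have hm : ∀ (b : Bool) (j : Fin m) (i : Fin n),
      Measurable fun p : (Fin n → I) × (Fin m → I) =>
        bernoulliMeasure true false (edgeProb c₀ c₁ Δ n (p.2 j) (p.1 i)) {b} := by
    intro b j i
    have h1 : Measurable fun p : (Fin n → I) × (Fin m → I) => (p.2 j, p.1 i) := by fun_prop
    have h2 := (measurable_edgeProb c₀ c₁ Δ n).comp h1
    have h3 := (measurable_bernoulliMeasure_singleton b).comp h2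
    simpa only [Function.comp_def] using h3
  have hs : ∀ (s : Set (Fin m → Fin n → Bool)) (p : (Fin n → I) × (Fin m → I)),
      edgeMeasure c₀ c₁ Δ n m p s = ∑ b ∈ s.toFinite.toFinset, ∏ j, ∏ i,
        bernoulliMeasure true false (edgeProb c₀ c₁ Δ n (p.2 j) (p.1 i)) {b j i} := by
    intro s p
    conv_lhs => rw [← s.toFinite.coe_toFinset, ← sum_measure_singleton]
    simp only [edgeMeasure, Measure.pi_singleton]
  refine Measure.measurable_of_measurable_coe _ fun s _ => ?_
  simp only [hs]
  exact Finset.measurable_sum _ fun b _ => Finset.measurable_prod _ fun j _ =>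
    Finset.measurable_prod _ fun i _ => hm (b j i) j i

/-- The conditional law of the edges given the latent positions. -/
noncomputable def edgeKernel (c₀ c₁ Δ : ℝ) (n m : ℕ) :
    Kernel ((Fin n → I) × (Fin m → I)) (Fin m → Fin n → Bool) where
  toFun := edgeMeasure c₀ c₁ Δ n m
  measurable' := measurable_edgeMeasure c₀ c₁ Δ n m

instance (c₀ c₁ Δ : ℝ) (n m : ℕ) : IsMarkovKernel (edgeKernel c₀ c₁ Δ n m) :=
  ⟨fun p => inferInstanceAs (IsProbabilityMeasure (edgeMeasure c₀ c₁ Δ n m p))⟩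

/-- The joint law of the bipartite model with `n` influencers and `m` followers: the positions
`x_1, …, x_n, y_1, …, y_m` are i.i.d. with law `D`, and given them the edges are drawn from
`edgeKernel`. A sample point is `((x, y), b)`. -/
noncomputable def law (c₀ c₁ Δ : ℝ) (D : Measure I) (n m : ℕ) :
    Measure (((Fin n → I) × (Fin m → I)) × (Fin m → Fin n → Bool)) :=
  ((Measure.pi fun _ => D).prod (Measure.pi fun _ => D)) ⊗ₘ edgeKernel c₀ c₁ Δ n m

instance (c₀ c₁ Δ : ℝ) (D : Measure I) [IsProbabilityMeasure D] (n m : ℕ) :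
    IsProbabilityMeasure (law c₀ c₁ Δ D n m) := by
  unfold law
  infer_instance

/-- The `m × n` follower–influencer adjacency matrix `B`. -/
def adjMatrix {n m : ℕ} (b : Fin m → Fin n → Bool) : Matrix (Fin m) (Fin n) ℝ :=
  Matrix.of fun j i => if b j i then 1 else 0

/-- `A`: the matrix `Bᵀ B` with its diagonal set to zero. -/
def coMatrix {n m : ℕ} (b : Fin m → Fin n → Bool) : Matrix (Fin n) (Fin n) ℝ :=
  Matrix.of fun i i' =>
    if i = i' then 0 else ((adjMatrix b).transpose * adjMatrix b) i i'

/-- `M`: the Gram matrix `M i i' = μ(x_i, x_{i'})`. -/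
noncomputable def gramMatrix (c₀ c₁ Δ : ℝ) (D : Measure I) {n : ℕ} (x : Fin n → I) :
    Matrix (Fin n) (Fin n) ℝ :=
  Matrix.of fun i i' => sqKernel c₀ c₁ Δ D (x i) (x i')

/-- The spectral norm of a square real matrix: the operator norm on Euclidean space. -/
noncomputable def specNorm {n : ℕ} (X : Matrix (Fin n) (Fin n) ℝ) : ℝ :=
  ‖Matrix.toEuclideanCLM (n := Fin n) (𝕜 := ℝ) X‖

end BipartiteModel

/-! Fix the influencer positions `x` and integrate out the follower positions. The edges within a
row of `B` remain dependent, but the rows become i.i.d. with law `rowWeight`. Hence `A` is a sum of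
`m` i.i.d. symmetric matrices `rowGram (b j)` with mean `meanGram`, and `n · meanGram` is `M / n`
with its diagonal removed. The removed diagonal has norm at most `1/n`, which is below `(n/m)^(1/4)`
once `m ≤ n²`. It remains to bound the norm of the centred sum `S`, uniformly in `x`.

This is done by the method of exchangeable pairs for even trace moments, as in a matrix
Burkholder–Davis–Gundy inequality. Resampling one row and applying a mean value trace inequality
bounds `E tr S^(2p)` by `2p - 1` times a sum of terms `E tr (Z_j - Z_j')² S^(2p-2)`. Young's
inequality in the eigenbasis of `S` absorbs the power of `S`, leaving `n` times the `p`-th moment of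
a variance proxy (`sum_trace_centredSum_pow_le`). Here the proxy is the squared maximal row degree
times the maximal column degree. Exponential moments of the degrees show that its `p`-th moment is
at most polynomial in `n, m` times `(const · p⁴ · m/n)^p` (`sum_trace_rowGram_pow_le`).

Markov's inequality at the level `(m/n) (n/m)^(1/4)` then gives a tail of order `(const · p⁵ ·
√(n/m))^p` up to polynomial factors. With `p = ⌈log n⌉` and `m ≳ n log¹² n` the base is `O(1 / log
n)`, so the tail beats every power of `n`. -/

namespace BipartiteModel

open Matrix

/-! ### Trace inequalities for symmetric matrices, and the spectral norm via even traces. -/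

section Spectral

variable {ι : Type*} [Fintype ι] [DecidableEq ι]

lemma exists_orthogonal_diagonalization {S : Matrix ι ι ℝ} (hS : S.IsSymm) :
    ∃ (l : ι → ℝ) (U : Matrix ι ι ℝ), Uᵀ * U = 1 ∧ U * Uᵀ = 1 ∧
      ∀ a : ℕ, S ^ a = U * diagonal (fun i => l i ^ a) * Uᵀ := by
  have hH : S.IsHermitian := by
    rw [Matrix.IsHermitian, conjTranspose_eq_transpose_of_trivial]; exact hS
  set U : Matrix ι ι ℝ := (hH.eigenvectorUnitary : Matrix ι ι ℝ) with hU
  have hstar : star U = Uᵀ := by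
    rw [star_eq_conjTranspose, conjTranspose_eq_transpose_of_trivial]
  have h1 : Uᵀ * U = 1 := by
    rw [← hstar]; exact Unitary.coe_star_mul_self hH.eigenvectorUnitary
  have h2 : U * Uᵀ = 1 := by
    rw [← hstar]; exact Unitary.coe_mul_star_self hH.eigenvectorUnitary
  refine ⟨hH.eigenvalues, U, h1, h2, fun a => ?_⟩
  have hsp : S = U * diagonal hH.eigenvalues * Uᵀ := by
    conv_lhs => rw [hH.spectral_theorem]
    rw [Unitary.conjStarAlgAut_apply, ← hstar]
    rfl
  induction a with
  | zero => simp [h2]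
  | succ a ih =>
    rw [pow_succ, ih]
    nth_rewrite 2 [hsp]
    calc U * diagonal (fun i => hH.eigenvalues i ^ a) * Uᵀ * (U * diagonal hH.eigenvalues * Uᵀ)
        = U * diagonal (fun i => hH.eigenvalues i ^ a) * (Uᵀ * U) * diagonal hH.eigenvalues
            * Uᵀ := by simp only [Matrix.mul_assoc]
      _ = _ := by
        rw [h1, Matrix.mul_one, Matrix.mul_assoc U, diagonal_mul_diagonal]
        simp only [pow_succ]

/-- The weights are the squared inner products of the eigenvectors of `S` with those of `T`. They
act as a joint spectral measure for a non-commuting pair: a trace inequality linear in the products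
`S ^ a * T ^ b` follows from the scalar inequality at each pair of eigenvalues. -/
lemma trace_pow_mul_pow {S T : Matrix ι ι ℝ} (hS : S.IsSymm) (hT : T.IsSymm) :
    ∃ (l k : ι → ℝ) (w : ι → ι → ℝ), (∀ i j, 0 ≤ w i j) ∧
      ∀ a b : ℕ, (S ^ a * T ^ b).trace = ∑ i, ∑ j, w i j * (l i ^ a * k j ^ b) := by
  obtain ⟨l, U, -, -, hl⟩ := exists_orthogonal_diagonalization hS
  obtain ⟨k, V, -, -, hk⟩ := exists_orthogonal_diagonalization hT
  refine ⟨l, k, fun i j => (Uᵀ * V) i j ^ 2, fun i j => sq_nonneg _, fun a b => ?_⟩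
  have : (S ^ a * T ^ b).trace
      = (diagonal (fun i => l i ^ a) * (Uᵀ * V) * (diagonal (fun i => k i ^ b) *
          (Uᵀ * V)ᵀ)).trace := by
    rw [hl, hk, Matrix.mul_assoc U, Matrix.mul_assoc U, Matrix.trace_mul_comm U]
    simp only [Matrix.mul_assoc, transpose_mul, transpose_transpose]
  rw [this]
  simp only [Matrix.trace, diag_apply, Matrix.mul_apply (M := _ * _), diagonal_mul,
    transpose_apply]
  refine Finset.sum_congr rfl fun i _ => Finset.sum_congr rfl fun j _ => ?_
  ring

lemma pow_mul_pow_le_add {x y : ℝ} {r a b : ℕ} (hab : a + b = 2 * r) :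
    x ^ a * y ^ b ≤ x ^ (2 * r) + y ^ (2 * r) := by
  have hx : |x| ^ (2 * r) = x ^ (2 * r) := by rw [pow_mul, pow_mul, sq_abs]
  have hy : |y| ^ (2 * r) = y ^ (2 * r) := by rw [pow_mul, pow_mul, sq_abs]
  have h0 : x ^ a * y ^ b ≤ |x| ^ a * |y| ^ b := by
    rw [← abs_pow, ← abs_pow, ← abs_mul]; exact le_abs_self _
  refine h0.trans ?_
  rw [← hx, ← hy]
  rcases le_total |x| |y| with h | h
  · calc |x| ^ a * |y| ^ b ≤ |y| ^ a * |y| ^ b := by gcongr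
      _ = |y| ^ (2 * r) := by rw [← pow_add, hab]
      _ ≤ _ := le_add_of_nonneg_left (by positivity)
  · calc |x| ^ a * |y| ^ b ≤ |x| ^ a * |x| ^ b := by gcongr
      _ = |x| ^ (2 * r) := by rw [← pow_add, hab]
      _ ≤ _ := le_add_of_nonneg_right (by positivity)

/-- Factoring out `x - y` leaves `2r + 1` mixed monomials of even total degree `2r`, each dominated
by the sum of the two pure powers. -/
lemma sub_mul_pow_sub_pow_le (x y : ℝ) (r : ℕ) :
    (x - y) * (x ^ (2 * r + 1) - y ^ (2 * r + 1)) ≤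
      (2 * r + 1 : ℝ) * ((x - y) ^ 2 * (x ^ (2 * r) + y ^ (2 * r))) := by
  have h := (Commute.all x y).geom_sum₂_mul (2 * r + 1)
  rw [← h]
  have hs : ∑ i ∈ Finset.range (2 * r + 1), x ^ i * y ^ (2 * r + 1 - 1 - i) ≤
      (2 * r + 1 : ℝ) * (x ^ (2 * r) + y ^ (2 * r)) := by
    refine (Finset.sum_le_card_nsmul _ _ (x ^ (2 * r) + y ^ (2 * r)) fun i hi => ?_).trans ?_
    · have := Finset.mem_range.1 hi
      exact pow_mul_pow_le_add (by omega)
    · simp [mul_add]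
  nlinarith [mul_le_mul_of_nonneg_left hs (sq_nonneg (x - y))]

/-- The mean value trace inequality for odd powers of symmetric matrices. -/
lemma trace_sub_mul_pow_sub_pow_le {S T : Matrix ι ι ℝ} (hS : S.IsSymm) (hT : T.IsSymm)
    (r : ℕ) :
    ((S - T) * (S ^ (2 * r + 1) - T ^ (2 * r + 1))).trace ≤
      (2 * r + 1 : ℝ) * (((S - T) * (S - T) * S ^ (2 * r)).trace +
        ((S - T) * (S - T) * T ^ (2 * r)).trace) := by
  obtain ⟨l, k, w, hw, h⟩ := trace_pow_mul_pow hS hT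
  have h1 : ((S - T) * (S ^ (2 * r + 1) - T ^ (2 * r + 1))).trace =
      ∑ i, ∑ j, w i j * ((l i - k j) * (l i ^ (2 * r + 1) - k j ^ (2 * r + 1))) := by
    have e : ((S - T) * (S ^ (2 * r + 1) - T ^ (2 * r + 1))).trace =
        (S ^ (2 * r + 2) * T ^ 0).trace - (S ^ 1 * T ^ (2 * r + 1)).trace -
        (S ^ (2 * r + 1) * T ^ 1).trace + (S ^ 0 * T ^ (2 * r + 2)).trace := by
      rw [Matrix.trace_mul_comm (S ^ (2 * r + 1)) (T ^ 1)]
      simp only [sub_mul, mul_sub, trace_sub, pow_zero, pow_one, mul_one, one_mul,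
        pow_succ' _ (2 * r + 1)]
      ring
    rw [e, h, h, h, h]
    simp only [← Finset.sum_sub_distrib, ← Finset.sum_add_distrib]
    refine Finset.sum_congr rfl fun i _ => Finset.sum_congr rfl fun j _ => ?_
    ring
  have h2 : ((S - T) * (S - T) * S ^ (2 * r)).trace =
      ∑ i, ∑ j, w i j * ((l i - k j) ^ 2 * l i ^ (2 * r)) := by
    have e : ((S - T) * (S - T) * S ^ (2 * r)).trace =
        (S ^ (2 * r + 2) * T ^ 0).trace - (S ^ (2 * r + 1) * T ^ 1).trace -
        (S ^ (2 * r + 1) * T ^ 1).trace + (S ^ (2 * r) * T ^ 2).trace := by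
      have e1 : (S * T * S ^ (2 * r)).trace = (S ^ (2 * r + 1) * T ^ 1).trace := by
        rw [Matrix.trace_mul_comm, pow_one, ← Matrix.mul_assoc, ← pow_succ]
      have e2 : (T * S * S ^ (2 * r)).trace = (S ^ (2 * r + 1) * T ^ 1).trace := by
        rw [Matrix.mul_assoc, Matrix.trace_mul_comm, pow_one, ← pow_succ']
      have e3 : (T * T * S ^ (2 * r)).trace = (S ^ (2 * r) * T ^ 2).trace := by
        rw [Matrix.trace_mul_comm, pow_two]
      have e4 : (S * S * S ^ (2 * r)).trace = (S ^ (2 * r + 2) * T ^ 0).trace := by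
        rw [pow_zero, mul_one, ← pow_two, ← pow_add, add_comm]
      simp only [sub_mul, mul_sub, trace_sub, e1, e2, e3, e4]
      ring
    rw [e, h, h, h]
    simp only [← Finset.sum_sub_distrib, ← Finset.sum_add_distrib]
    refine Finset.sum_congr rfl fun i _ => Finset.sum_congr rfl fun j _ => ?_
    ring
  have h3 : ((S - T) * (S - T) * T ^ (2 * r)).trace =
      ∑ i, ∑ j, w i j * ((l i - k j) ^ 2 * k j ^ (2 * r)) := by
    have e : ((S - T) * (S - T) * T ^ (2 * r)).trace =
        (S ^ 2 * T ^ (2 * r)).trace - (S ^ 1 * T ^ (2 * r + 1)).trace -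
        (S ^ 1 * T ^ (2 * r + 1)).trace + (S ^ 0 * T ^ (2 * r + 2)).trace := by
      have e1 : (S * T * T ^ (2 * r)).trace = (S ^ 1 * T ^ (2 * r + 1)).trace := by
        rw [Matrix.mul_assoc, pow_one, ← pow_succ']
      have e2 : (T * S * T ^ (2 * r)).trace = (S ^ 1 * T ^ (2 * r + 1)).trace := by
        rw [Matrix.mul_assoc, Matrix.trace_mul_comm, pow_one, Matrix.mul_assoc, ← pow_succ]
      have e3 : (S * S * T ^ (2 * r)).trace = (S ^ 2 * T ^ (2 * r)).trace := by
        rw [pow_two]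
      have e4 : (T * T * T ^ (2 * r)).trace = (S ^ 0 * T ^ (2 * r + 2)).trace := by
        rw [pow_zero, one_mul, ← pow_two, ← pow_add, add_comm]
      simp only [sub_mul, mul_sub, trace_sub, e1, e2, e3, e4]
      ring
    rw [e, h, h, h]
    simp only [← Finset.sum_sub_distrib, ← Finset.sum_add_distrib]
    refine Finset.sum_congr rfl fun i _ => Finset.sum_congr rfl fun j _ => ?_
    ring
  rw [h1, h2, h3, ← Finset.sum_add_distrib, Finset.mul_sum]
  refine Finset.sum_le_sum fun i _ => ?_
  rw [← Finset.sum_add_distrib, Finset.mul_sum]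
  refine Finset.sum_le_sum fun j _ => ?_
  calc w i j * ((l i - k j) * (l i ^ (2 * r + 1) - k j ^ (2 * r + 1)))
      ≤ w i j * ((2 * r + 1 : ℝ) * ((l i - k j) ^ 2 * (l i ^ (2 * r) + k j ^ (2 * r)))) :=
        mul_le_mul_of_nonneg_left (sub_mul_pow_sub_pow_le _ _ r) (hw i j)
    _ = _ := by ring

/-- Young's inequality with exponents `r + 1` and `(r + 1) / r`, in polynomial form. The induction
step multiplies by `w` and adds `(r + 1) z^r (z - w)² ≥ 0`. -/
lemma young_pow (r : ℕ) {w z : ℝ} (hw : 0 ≤ w) (hz : 0 ≤ z) :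
    (r + 1 : ℝ) * (w * z ^ r) ≤ r * z ^ (r + 1) + w ^ (r + 1) := by
  induction r with
  | zero => simp
  | succ r ih =>
    have h1 := mul_le_mul_of_nonneg_left ih hw
    have h2 : 0 ≤ (r + 1 : ℝ) * (z ^ r * (z - w) ^ 2) := by positivity
    push_cast
    have e1 : z ^ (r + 1 + 1) = z ^ r * z ^ 2 := by ring
    have e2 : z ^ (r + 1) = z ^ r * z := by ring
    have e3 : w ^ (r + 1 + 1) = w * w ^ (r + 1) := by ring
    rw [e1, e2, e3]
    rw [e2] at h1
    nlinarith

lemma trace_mul_self_mul_pow {S : Matrix ι ι ℝ} (hS : S.IsSymm) :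
    ∃ (l : ι → ℝ) (u : ι → ι → ℝ), (∀ i, u i ⬝ᵥ u i = 1) ∧
      (∀ a : ℕ, (S ^ a).trace = ∑ i, l i ^ a) ∧
      ∀ (a : ℕ) (H : Matrix ι ι ℝ), H.IsSymm →
        (H * H * S ^ a).trace = ∑ i, l i ^ a * ((H *ᵥ u i) ⬝ᵥ (H *ᵥ u i)) := by
  obtain ⟨l, U, hU, -, hl⟩ := exists_orthogonal_diagonalization hS
  -- The rows of `Uᵀ` are the columns of `U`, that is, the eigenvectors of `S`.
  refine ⟨l, fun i => Uᵀ i, fun i => ?_, fun a => ?_, fun a H hH => ?_⟩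
  · have := congrFun (congrFun hU i) i
    simpa [Matrix.mul_apply, dotProduct] using this
  · rw [hl, Matrix.trace_mul_comm, ← Matrix.mul_assoc, hU, Matrix.one_mul, trace_diagonal]
  · have : (H * H * S ^ a).trace = (diagonal (fun i => l i ^ a) * ((H * U)ᵀ * (H * U))).trace := by
      rw [hl, Matrix.trace_mul_comm, transpose_mul, hH.eq, Matrix.mul_assoc, Matrix.mul_assoc,
        Matrix.trace_mul_comm]
      simp only [Matrix.mul_assoc]
    rw [this]
    simp only [Matrix.trace, diag_apply, diagonal_mul]
    refine Finset.sum_congr rfl fun i _ => ?_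
    congr 1

/-- A family of symmetric matrices whose squares sum to at most `v`, against an even power. -/
lemma sum_trace_mul_pow_le {J : Type*} [Fintype J] {S : Matrix ι ι ℝ} (hS : S.IsSymm)
    (H : J → Matrix ι ι ℝ) (hH : ∀ j, (H j).IsSymm) {v c : ℝ} (hv : 0 ≤ v) (hc : 0 ≤ c)
    (h : ∀ u : ι → ℝ, ∑ j, (H j *ᵥ u) ⬝ᵥ (H j *ᵥ u) ≤ v * (u ⬝ᵥ u)) (r : ℕ) :
    (r + 1 : ℝ) * (c * ∑ j, (H j * H j * S ^ (2 * r)).trace) ≤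
      r * (S ^ (2 * (r + 1))).trace + Fintype.card ι * (c * v) ^ (r + 1) := by
  obtain ⟨l, u, hu, htr, htrH⟩ := trace_mul_self_mul_pow hS
  have e : ∑ j, (H j * H j * S ^ (2 * r)).trace =
      ∑ i, l i ^ (2 * r) * ∑ j, (H j *ᵥ u i) ⬝ᵥ (H j *ᵥ u i) := by
    simp only [htrH _ _ (hH _), Finset.mul_sum]
    exact Finset.sum_comm
  have hcard : (Fintype.card ι : ℝ) * (c * v) ^ (r + 1) = ∑ _i : ι, (c * v) ^ (r + 1) := by
    simp
  rw [e, htr, hcard, Finset.mul_sum, Finset.mul_sum, Finset.mul_sum, ← Finset.sum_add_distrib]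
  refine Finset.sum_le_sum fun i _ => ?_
  have h1 := h (u i)
  rw [hu, mul_one] at h1
  -- Young is applied to each eigenvalue separately, so the `S`-part sums to a trace and the
  -- `v`-part picks up the dimension.
  have h2 := young_pow r (w := c * v) (z := l i ^ 2) (by positivity) (by positivity)
  rw [← pow_mul, ← pow_mul] at h2
  refine le_trans ?_ h2
  have h3 : 0 ≤ l i ^ (2 * r) := by rw [pow_mul]; positivity
  calc (r + 1 : ℝ) * (c * (l i ^ (2 * r) * ∑ j, (H j *ᵥ u i) ⬝ᵥ (H j *ᵥ u i)))
      ≤ (r + 1 : ℝ) * (c * (l i ^ (2 * r) * v)) := by gcongr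
    _ = _ := by ring

lemma trace_pow_two_mul_nonneg {S : Matrix ι ι ℝ} (hS : S.IsSymm) (p : ℕ) :
    0 ≤ (S ^ (2 * p)).trace := by
  obtain ⟨l, u, hu, htr, -⟩ := trace_mul_self_mul_pow hS
  rw [htr]
  exact Finset.sum_nonneg fun i _ => by rw [pow_mul]; positivity

end Spectral

/-- The trace of an even power is a sum of nonnegative powers of eigenvalues, so it dominates each
of them. -/
lemma specNorm_le_of_trace_pow_le {n p : ℕ} (hp : p ≠ 0) {S : Matrix (Fin n) (Fin n) ℝ}
    (hS : S.IsSymm) {t : ℝ} (ht : 0 ≤ t) (h : (S ^ (2 * p)).trace ≤ t ^ (2 * p)) :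
    specNorm S ≤ t := by
  obtain ⟨l, U, hU, hU', hl⟩ := exists_orthogonal_diagonalization hS
  have htr : (S ^ (2 * p)).trace = ∑ i, l i ^ (2 * p) := by
    rw [hl, Matrix.trace_mul_comm, ← Matrix.mul_assoc, hU, Matrix.one_mul, trace_diagonal]
  have hli : ∀ i, l i ^ 2 ≤ t ^ 2 := by
    intro i
    have h1 : l i ^ (2 * p) ≤ t ^ (2 * p) := by
      refine le_trans ?_ (htr ▸ h)
      exact Finset.single_le_sum (f := fun i => l i ^ (2 * p))
        (fun i _ => by rw [pow_mul]; positivity) (Finset.mem_univ i)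
    rw [pow_mul, pow_mul] at h1
    exact (pow_le_pow_iff_left₀ (by positivity) (by positivity) hp).1 h1
  refine ContinuousLinearMap.opNorm_le_bound _ ht fun u => ?_
  refine (sq_le_sq₀ (norm_nonneg _) (by positivity)).1 ?_
  rw [mul_pow, EuclideanSpace.real_norm_sq_eq, EuclideanSpace.real_norm_sq_eq]
  have e1 : ∑ i, (Matrix.toEuclideanCLM (n := Fin n) (𝕜 := ℝ) S u) i ^ 2
      = (S *ᵥ u.ofLp) ⬝ᵥ (S *ᵥ u.ofLp) := by
    simp [dotProduct, pow_two]
  have e2 : ∑ i, u i ^ 2 = u.ofLp ⬝ᵥ u.ofLp := by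
    simp [dotProduct, pow_two]
  rw [e1, e2]
  have e3 : (S *ᵥ u.ofLp) ⬝ᵥ (S *ᵥ u.ofLp) = ∑ i, l i ^ 2 * (Uᵀ *ᵥ u.ofLp) i ^ 2 := by
    have : (S *ᵥ u.ofLp) ⬝ᵥ (S *ᵥ u.ofLp) = u.ofLp ⬝ᵥ ((S ^ 2) *ᵥ u.ofLp) := by
      rw [pow_two, ← mulVec_mulVec, dotProduct_mulVec u.ofLp, ← mulVec_transpose, hS.eq]
    rw [this, hl, ← mulVec_mulVec, ← mulVec_mulVec, dotProduct_mulVec, ← mulVec_transpose]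
    simp only [dotProduct, mulVec_diagonal]
    exact Finset.sum_congr rfl fun i _ => by ring
  have e4 : u.ofLp ⬝ᵥ u.ofLp = ∑ i, (Uᵀ *ᵥ u.ofLp) i ^ 2 := by
    have : u.ofLp ⬝ᵥ u.ofLp = u.ofLp ⬝ᵥ ((U * Uᵀ) *ᵥ u.ofLp) := by rw [hU', one_mulVec]
    rw [this, ← mulVec_mulVec, dotProduct_mulVec, ← mulVec_transpose]
    simp only [dotProduct, pow_two]
  rw [e3, e4, Finset.mul_sum]
  exact Finset.sum_le_sum fun i _ => mul_le_mul_of_nonneg_right (hli i) (sq_nonneg _)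

/-! ### Exchangeable pairs: trace moments of sums of i.i.d. symmetric matrices. -/

section Exchange

variable {Ω J ι : Type*} [Fintype J]

/-- The weight of a sample of independent points with common weight function `q`. -/
def prodWeight (q : Ω → ℝ) (b : J → Ω) : ℝ := ∏ j, q (b j)

lemma prodWeight_nonneg {q : Ω → ℝ} (hq : ∀ β, 0 ≤ q β) (b : J → Ω) : 0 ≤ prodWeight q b :=
  Finset.prod_nonneg fun _ _ => hq _

/-- The sum of the values of `Z` along a sample, centred at `m`. -/
def centredSum (Z : Ω → Matrix ι ι ℝ) (m : Matrix ι ι ℝ) (b : J → Ω) : Matrix ι ι ℝ :=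
  ∑ j, (Z (b j) - m)

lemma centredSum_isSymm {Z : Ω → Matrix ι ι ℝ} {m : Matrix ι ι ℝ} (hZ : ∀ β, (Z β).IsSymm)
    (hm : m.IsSymm) (b : J → Ω) : (centredSum Z m b).IsSymm := by
  unfold centredSum
  rw [Matrix.IsSymm, Matrix.transpose_sum]
  exact Finset.sum_congr rfl fun j _ => by rw [transpose_sub, (hZ _).eq, hm.eq]

variable [DecidableEq J]

lemma sum_prodWeight_mul_prod [Fintype Ω] (q : Ω → ℝ) (h : J → Ω → ℝ) :
    ∑ b : J → Ω, prodWeight q b * ∏ j, h j (b j) = ∏ j, ∑ β, q β * h j β := by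
  rw [Finset.prod_univ_sum, Fintype.piFinset_univ]
  exact Finset.sum_congr rfl fun b _ => Finset.prod_mul_distrib.symm

lemma sum_prodWeight [Fintype Ω] {q : Ω → ℝ} (hq : ∑ β, q β = 1) :
    ∑ b : J → Ω, prodWeight q b = 1 := by
  have := sum_prodWeight_mul_prod (J := J) q fun _ _ => 1
  simpa [hq] using this

lemma sum_prodWeight_mul_apply [Fintype Ω] {q : Ω → ℝ} (hq : ∑ β, q β = 1) (j : J) (g : Ω → ℝ) :
    ∑ b : J → Ω, prodWeight q b * g (b j) = ∑ β, q β * g β := by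
  have := sum_prodWeight_mul_prod (J := J) q fun i β => if i = j then g β else 1
  simp only [Finset.prod_ite_eq', Finset.mem_univ, if_true] at this
  rw [this, Finset.prod_eq_single j]
  · simp
  · intro i _ hi
    simp [hi, hq]
  · simp

/-- Exchange the `j`-th coordinates of two samples. -/
def coordSwap (j : J) : Equiv.Perm ((J → Ω) × (J → Ω)) where
  toFun z := (Function.update z.1 j (z.2 j), Function.update z.2 j (z.1 j))
  invFun z := (Function.update z.1 j (z.2 j), Function.update z.2 j (z.1 j))
  left_inv z := by simp
  right_inv z := by simp

lemma prodWeight_coordSwap (q : Ω → ℝ) (j : J) (z : (J → Ω) × (J → Ω)) :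
    prodWeight q (coordSwap j z).1 * prodWeight q (coordSwap j z).2 =
      prodWeight q z.1 * prodWeight q z.2 := by
  simp only [prodWeight, ← Finset.prod_mul_distrib]
  refine Finset.prod_congr rfl fun i _ => ?_
  by_cases h : i = j
  · subst h
    simp [coordSwap, mul_comm]
  · simp [coordSwap, h]

/-- This is exchangeability: two independent samples keep their joint law when their `j`-th
coordinates are exchanged. -/
lemma sum_comp_coordSwap [Fintype Ω] (q : Ω → ℝ) (j : J) (f : (J → Ω) × (J → Ω) → ℝ) :
    ∑ z, prodWeight q z.1 * prodWeight q z.2 * f (coordSwap j z) =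
      ∑ z, prodWeight q z.1 * prodWeight q z.2 * f z := by
  rw [← Equiv.sum_comp (coordSwap j) fun z => prodWeight q z.1 * prodWeight q z.2 * f z]
  exact Finset.sum_congr rfl fun z _ => by rw [prodWeight_coordSwap]

lemma sum_pair_fst [Fintype Ω] {q : Ω → ℝ} (hq : ∑ β, q β = 1) (f : (J → Ω) → ℝ) :
    ∑ z : (J → Ω) × (J → Ω), prodWeight q z.1 * prodWeight q z.2 * f z.1 =
      ∑ b, prodWeight q b * f b := by
  rw [Fintype.sum_prod_type]
  refine Finset.sum_congr rfl fun b _ => ?_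
  calc ∑ b', prodWeight q b * prodWeight q b' * f b
      = (prodWeight q b * f b) * ∑ b', prodWeight q b' := by
        rw [Finset.mul_sum]; exact Finset.sum_congr rfl fun _ _ => by ring
    _ = _ := by rw [sum_prodWeight hq, mul_one]

lemma sum_pair_snd [Fintype Ω] {q : Ω → ℝ} (hq : ∑ β, q β = 1) (f : (J → Ω) → ℝ) :
    ∑ z : (J → Ω) × (J → Ω), prodWeight q z.1 * prodWeight q z.2 * f z.2 =
      ∑ b, prodWeight q b * f b := by
  rw [← sum_pair_fst hq f, ← Equiv.sum_comp (Equiv.prodComm _ _)]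
  exact Finset.sum_congr rfl fun z _ => by simp [mul_comm]

lemma centredSum_sub_coordSwap (Z : Ω → Matrix ι ι ℝ) (m : Matrix ι ι ℝ) (j : J)
    (z : (J → Ω) × (J → Ω)) :
    centredSum Z m z.1 - centredSum Z m (coordSwap j z).1 = Z (z.1 j) - Z (z.2 j) := by
  unfold centredSum
  rw [← Finset.sum_sub_distrib, Finset.sum_eq_single j]
  · simp [coordSwap]
  · intro i _ hi
    simp [coordSwap, hi]
  · simp

variable [Fintype ι] [DecidableEq ι]

/-- Replacing one independent coordinate bounds its contribution to an even trace moment. -/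
lemma sum_trace_coord_mul_pow_le [Fintype Ω] {q : Ω → ℝ} (hq0 : ∀ β, 0 ≤ q β)
    (hq : ∑ β, q β = 1) {Z : Ω → Matrix ι ι ℝ} {m : Matrix ι ι ℝ} (hZ : ∀ β, (Z β).IsSymm)
    (hm : m.IsSymm) (hmean : ∑ β, q β • Z β = m) (r : ℕ) (j : J) :
    ∑ b : J → Ω, prodWeight q b * ((Z (b j) - m) * centredSum Z m b ^ (2 * r + 1)).trace ≤
      (2 * r + 1 : ℝ) * ∑ z : (J → Ω) × (J → Ω), prodWeight q z.1 * prodWeight q z.2 *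
        ((Z (z.1 j) - Z (z.2 j)) * (Z (z.1 j) - Z (z.2 j)) *
          centredSum Z m z.1 ^ (2 * r)).trace := by
  set k := 2 * r + 1 with hk
  set S : (J → Ω) → Matrix ι ι ℝ := centredSum Z m with hS
  have hA := sum_pair_fst hq fun b : J → Ω => ((Z (b j) - m) * S b ^ k).trace
  have hA' := sum_comp_coordSwap q j fun z : (J → Ω) × (J → Ω) =>
    ((Z (z.1 j) - m) * S z.1 ^ k).trace
  -- `Z (z.2 j) - m` has mean zero and is independent of `S z.1`, which depends on the first sample
  -- only.
  have hB' : ∑ z : (J → Ω) × (J → Ω), prodWeight q z.1 * prodWeight q z.2 *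
      ((Z (z.2 j) - m) * S z.1 ^ k).trace = 0 := by
    rw [Fintype.sum_prod_type]
    refine Finset.sum_eq_zero fun b _ => ?_
    have h1 := sum_prodWeight_mul_apply (J := J) hq j fun β => ((Z β - m) * S b ^ k).trace
    have h2 : ∑ β, q β * ((Z β - m) * S b ^ k).trace = 0 := by
      have : ∑ β, q β * ((Z β - m) * S b ^ k).trace
          = ((∑ β, q β • (Z β - m)) * S b ^ k).trace := by
        rw [Finset.sum_mul, trace_sum]
        exact Finset.sum_congr rfl fun β _ => by simp
      rw [this]
      simp only [smul_sub, Finset.sum_sub_distrib, hmean, ← Finset.sum_smul, hq, one_smul,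
        sub_self, Matrix.zero_mul, trace_zero]
    calc ∑ b', prodWeight q b * prodWeight q b' * ((Z (b' j) - m) * S b ^ k).trace
        = prodWeight q b * ∑ b', prodWeight q b' * ((Z (b' j) - m) * S b ^ k).trace := by
          rw [Finset.mul_sum]; exact Finset.sum_congr rfl fun _ _ => by ring
      _ = 0 := by rw [h1, h2, mul_zero]
  have hB := sum_comp_coordSwap q j fun z : (J → Ω) × (J → Ω) =>
    ((Z (z.2 j) - m) * S z.1 ^ k).trace
  have hV := sum_comp_coordSwap q j fun z : (J → Ω) × (J → Ω) =>
    ((Z (z.1 j) - Z (z.2 j)) * (Z (z.1 j) - Z (z.2 j)) * S z.1 ^ (2 * r)).trace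
  have hsw1 : ∀ z : (J → Ω) × (J → Ω), (coordSwap j z).1 j = z.2 j := by
    intro z; simp [coordSwap]
  have hsw2 : ∀ z : (J → Ω) × (J → Ω), (coordSwap j z).2 j = z.1 j := by
    intro z; simp [coordSwap]
  simp only [hsw1, hsw2] at hA' hB hV
  rw [← hA]
  have hle : ∑ z : (J → Ω) × (J → Ω), prodWeight q z.1 * prodWeight q z.2 *
      (((Z (z.1 j) - Z (z.2 j)) * (S z.1 ^ k - S (coordSwap j z).1 ^ k)).trace) ≤
      ∑ z : (J → Ω) × (J → Ω), prodWeight q z.1 * prodWeight q z.2 *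
      ((2 * r + 1 : ℝ) * (((Z (z.1 j) - Z (z.2 j)) * (Z (z.1 j) - Z (z.2 j)) *
        S z.1 ^ (2 * r)).trace +
        ((Z (z.2 j) - Z (z.1 j)) * (Z (z.2 j) - Z (z.1 j)) *
          S (coordSwap j z).1 ^ (2 * r)).trace)) := by
    refine Finset.sum_le_sum fun z _ => mul_le_mul_of_nonneg_left ?_
      (mul_nonneg (prodWeight_nonneg hq0 _) (prodWeight_nonneg hq0 _))
    have h := trace_sub_mul_pow_sub_pow_le (centredSum_isSymm hZ hm z.1)
      (centredSum_isSymm hZ hm (coordSwap j z).1) r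
    rw [centredSum_sub_coordSwap] at h
    have hneg : (Z (z.2 j) - Z (z.1 j)) * (Z (z.2 j) - Z (z.1 j)) =
        (Z (z.1 j) - Z (z.2 j)) * (Z (z.1 j) - Z (z.2 j)) := by
      rw [← neg_sub (Z (z.1 j)), neg_mul_neg]
    rw [hneg]
    exact h
  -- Expanding gives four terms: the two mixed ones vanish by independence, and the swap identifies
  -- the other two.
  have hL : ∑ z : (J → Ω) × (J → Ω), prodWeight q z.1 * prodWeight q z.2 *
      (((Z (z.1 j) - Z (z.2 j)) * (S z.1 ^ k - S (coordSwap j z).1 ^ k)).trace) =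
      2 * ∑ z : (J → Ω) × (J → Ω), prodWeight q z.1 * prodWeight q z.2 *
        ((Z (z.1 j) - m) * S z.1 ^ k).trace := by
    have e : ∀ z : (J → Ω) × (J → Ω), prodWeight q z.1 * prodWeight q z.2 *
      (((Z (z.1 j) - Z (z.2 j)) * (S z.1 ^ k - S (coordSwap j z).1 ^ k)).trace) =
      prodWeight q z.1 * prodWeight q z.2 * ((Z (z.1 j) - m) * S z.1 ^ k).trace -
      prodWeight q z.1 * prodWeight q z.2 * ((Z (z.2 j) - m) * S z.1 ^ k).trace -
      prodWeight q z.1 * prodWeight q z.2 *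
        ((Z (z.1 j) - m) * S (coordSwap j z).1 ^ k).trace +
      prodWeight q z.1 * prodWeight q z.2 *
        ((Z (z.2 j) - m) * S (coordSwap j z).1 ^ k).trace := by
      intro z
      simp only [sub_mul, mul_sub, trace_sub]
      ring
    simp only [e, Finset.sum_add_distrib, Finset.sum_sub_distrib]
    rw [hB, hB', hA']
    ring
  have hR : ∑ z : (J → Ω) × (J → Ω), prodWeight q z.1 * prodWeight q z.2 *
      ((2 * r + 1 : ℝ) * (((Z (z.1 j) - Z (z.2 j)) * (Z (z.1 j) - Z (z.2 j)) *
        S z.1 ^ (2 * r)).trace +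
        ((Z (z.2 j) - Z (z.1 j)) * (Z (z.2 j) - Z (z.1 j)) *
          S (coordSwap j z).1 ^ (2 * r)).trace)) =
      2 * ((2 * r + 1 : ℝ) * ∑ z : (J → Ω) × (J → Ω), prodWeight q z.1 * prodWeight q z.2 *
        ((Z (z.1 j) - Z (z.2 j)) * (Z (z.1 j) - Z (z.2 j)) * S z.1 ^ (2 * r)).trace) := by
    simp only [mul_add, Finset.sum_add_distrib, mul_left_comm _ (2 * (r : ℝ) + 1),
      ← Finset.mul_sum]
    rw [hV]
    ring
  rw [hL, hR] at hle
  linarith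

/-- A polynomial moment inequality for sums of independent symmetric random matrices. -/
theorem sum_trace_centredSum_pow_le [Fintype Ω] {q : Ω → ℝ} (hq0 : ∀ β, 0 ≤ q β)
    (hq : ∑ β, q β = 1) {Z : Ω → Matrix ι ι ℝ} {m : Matrix ι ι ℝ} (hZ : ∀ β, (Z β).IsSymm)
    (hm : m.IsSymm) (hmean : ∑ β, q β • Z β = m) {v : (J → Ω) → ℝ} (hv0 : ∀ b, 0 ≤ v b)
    (hv : ∀ b, ∀ u : ι → ℝ, ∑ j, (Z (b j) *ᵥ u) ⬝ᵥ (Z (b j) *ᵥ u) ≤ v b * (u ⬝ᵥ u)) (r : ℕ) :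
    ∑ b : J → Ω, prodWeight q b * (centredSum Z m b ^ (2 * (r + 1))).trace ≤
      Fintype.card ι * ∑ z : (J → Ω) × (J → Ω), prodWeight q z.1 * prodWeight q z.2 *
        ((2 * r + 1 : ℝ) * (2 * (v z.1 + v z.2))) ^ (r + 1) := by
  have hsplit : ∑ b : J → Ω, prodWeight q b * (centredSum Z m b ^ (2 * (r + 1))).trace =
      ∑ j, ∑ b : J → Ω, prodWeight q b *
        ((Z (b j) - m) * centredSum Z m b ^ (2 * r + 1)).trace := by
    rw [Finset.sum_comm]
    refine Finset.sum_congr rfl fun b _ => ?_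
    rw [← Finset.mul_sum, ← trace_sum, ← Finset.sum_mul, show 2 * (r + 1) = (2 * r + 1) + 1 by ring,
      pow_succ' _ (2 * r + 1)]
    rfl
  have h1 : ∑ b : J → Ω, prodWeight q b * (centredSum Z m b ^ (2 * (r + 1))).trace ≤
      ∑ z : (J → Ω) × (J → Ω), prodWeight q z.1 * prodWeight q z.2 * ((2 * r + 1 : ℝ) *
        ∑ j, ((Z (z.1 j) - Z (z.2 j)) * (Z (z.1 j) - Z (z.2 j)) *
          centredSum Z m z.1 ^ (2 * r)).trace) := by
    rw [hsplit]
    refine (Finset.sum_le_sum fun j _ =>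
      sum_trace_coord_mul_pow_le hq0 hq hZ hm hmean r j).trans_eq ?_
    rw [← Finset.mul_sum, Finset.sum_comm, Finset.mul_sum]
    refine Finset.sum_congr rfl fun z _ => ?_
    rw [← Finset.mul_sum]
    ring
  have h2 : ∀ z : (J → Ω) × (J → Ω), (r + 1 : ℝ) * ((2 * r + 1 : ℝ) *
        ∑ j, ((Z (z.1 j) - Z (z.2 j)) * (Z (z.1 j) - Z (z.2 j)) *
          centredSum Z m z.1 ^ (2 * r)).trace) ≤
      r * (centredSum Z m z.1 ^ (2 * (r + 1))).trace +
        Fintype.card ι * ((2 * r + 1 : ℝ) * (2 * (v z.1 + v z.2))) ^ (r + 1) := by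
    intro z
    have hvz := add_nonneg (hv0 z.1) (hv0 z.2)
    refine sum_trace_mul_pow_le (centredSum_isSymm hZ hm z.1)
      (fun j => Z (z.1 j) - Z (z.2 j)) (fun j => (hZ _).sub (hZ _)) (by linarith) (by positivity)
      (fun u => ?_) r
    -- The bound `|a - b|² ≤ 2|a|² + 2|b|²` separates the two samples, so a proxy for the uncentred
    -- matrices suffices.
    have h3 : ∀ j, ((Z (z.1 j) - Z (z.2 j)) *ᵥ u) ⬝ᵥ ((Z (z.1 j) - Z (z.2 j)) *ᵥ u) ≤
        2 * ((Z (z.1 j) *ᵥ u) ⬝ᵥ (Z (z.1 j) *ᵥ u)) +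
        2 * ((Z (z.2 j) *ᵥ u) ⬝ᵥ (Z (z.2 j) *ᵥ u)) := by
      intro j
      rw [sub_mulVec]
      simp only [dotProduct, Finset.mul_sum, ← Finset.sum_add_distrib]
      refine Finset.sum_le_sum fun i _ => ?_
      simp only [Pi.sub_apply]
      nlinarith [sq_nonneg ((Z (z.1 j) *ᵥ u) i + (Z (z.2 j) *ᵥ u) i)]
    refine (Finset.sum_le_sum fun j _ => h3 j).trans ?_
    rw [Finset.sum_add_distrib, ← Finset.mul_sum, ← Finset.mul_sum]
    have h4 := hv z.1 u
    have h5 := hv z.2 u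
    linarith
  have h3 : (r + 1 : ℝ) * ∑ z : (J → Ω) × (J → Ω), prodWeight q z.1 * prodWeight q z.2 *
        ((2 * r + 1 : ℝ) *
        ∑ j, ((Z (z.1 j) - Z (z.2 j)) * (Z (z.1 j) - Z (z.2 j)) *
          centredSum Z m z.1 ^ (2 * r)).trace) ≤
      r * ∑ b : J → Ω, prodWeight q b * (centredSum Z m b ^ (2 * (r + 1))).trace +
      Fintype.card ι * ∑ z : (J → Ω) × (J → Ω), prodWeight q z.1 * prodWeight q z.2 *
        ((2 * r + 1 : ℝ) * (2 * (v z.1 + v z.2))) ^ (r + 1) := by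
    rw [← sum_pair_fst hq fun b : J → Ω => (centredSum Z m b ^ (2 * (r + 1))).trace,
      Finset.mul_sum, Finset.mul_sum, Finset.mul_sum, ← Finset.sum_add_distrib]
    refine Finset.sum_le_sum fun z _ => ?_
    have := mul_le_mul_of_nonneg_left (h2 z)
      (mul_nonneg (prodWeight_nonneg hq0 z.1) (prodWeight_nonneg hq0 z.2))
    linarith
  -- Multiplying by `r + 1` leaves one copy of the moment after the `r` copies on the right of `h3`
  -- are absorbed.
  have h4 := mul_le_mul_of_nonneg_left h1 (by positivity : (0 : ℝ) ≤ r + 1)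
  linarith

end Exchange

/-! ### Row Gram matrices, the degree proxy and its moments. -/

/-- The `0`-`1` value of an edge. -/
def edgeVal (e : Bool) : ℝ := if e then 1 else 0

lemma edgeVal_nonneg (e : Bool) : 0 ≤ edgeVal e := by cases e <;> simp [edgeVal]

lemma edgeVal_mul_self (e : Bool) : edgeVal e * edgeVal e = edgeVal e := by
  cases e <;> simp [edgeVal]

/-- The contribution of one follower to `coMatrix`. -/
def rowGram {n : ℕ} (β : Fin n → Bool) : Matrix (Fin n) (Fin n) ℝ :=
  Matrix.of fun i k => if i = k then 0 else edgeVal (β i) * edgeVal (β k)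

/-- The number of influencers a follower interacts with. -/
def rowDegree {n : ℕ} (β : Fin n → Bool) : ℝ := ∑ i, edgeVal (β i)

/-- The number of followers of the influencer `i`. -/
def colDegree {n m : ℕ} (b : Fin m → Fin n → Bool) (i : Fin n) : ℝ := ∑ j, edgeVal (b j i)

lemma rowDegree_nonneg {n : ℕ} (β : Fin n → Bool) : 0 ≤ rowDegree β :=
  Finset.sum_nonneg fun _ _ => edgeVal_nonneg _

lemma colDegree_nonneg {n m : ℕ} (b : Fin m → Fin n → Bool) (i : Fin n) : 0 ≤ colDegree b i :=
  Finset.sum_nonneg fun _ _ => edgeVal_nonneg _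

lemma rowGram_isSymm {n : ℕ} (β : Fin n → Bool) : (rowGram β).IsSymm := by
  ext i i'
  simp only [rowGram, transpose_apply, of_apply, eq_comm (a := i'), mul_comm]

lemma coMatrix_eq_sum_rowGram {n m : ℕ} (b : Fin m → Fin n → Bool) :
    coMatrix b = ∑ j, rowGram (b j) := by
  ext i i'
  rw [Matrix.sum_apply]
  by_cases h : i = i'
  · simp [coMatrix, rowGram, h]
  · simp [coMatrix, rowGram, h, adjMatrix, edgeVal, Matrix.mul_apply]

/-- Cauchy–Schwarz. Keeping the indicator on `u` rather than bounding by `|u|²` is what turns the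
later sum over followers into column degrees. -/
lemma rowGram_mulVec_sq_le {n : ℕ} (β : Fin n → Bool) (u : Fin n → ℝ) :
    (rowGram β *ᵥ u) ⬝ᵥ (rowGram β *ᵥ u) ≤ rowDegree β ^ 2 * ∑ i, edgeVal (β i) * u i ^ 2 := by
  have h : ∀ i, (rowGram β *ᵥ u) i * (rowGram β *ᵥ u) i ≤
      edgeVal (β i) * (rowDegree β * ∑ i', edgeVal (β i') * u i' ^ 2) := by
    intro i
    have e : (rowGram β *ᵥ u) i =
        ∑ i', (if i = i' then 0 else edgeVal (β i) * edgeVal (β i')) * (edgeVal (β i') * u i') := by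
      simp only [mulVec, dotProduct, rowGram, of_apply]
      refine Finset.sum_congr rfl fun i' _ => ?_
      split_ifs
      · simp
      · rw [← mul_assoc, mul_assoc (edgeVal (β i)) (edgeVal (β i')) (edgeVal (β i')),
          edgeVal_mul_self]
    rw [e, ← pow_two]
    refine (Finset.sum_mul_sq_le_sq_mul_sq _ _ _).trans ?_
    rw [← mul_assoc]
    gcongr with i' _ i' _
    · exact mul_nonneg (edgeVal_nonneg _) (rowDegree_nonneg _)
    · rw [rowDegree, Finset.mul_sum]
      refine Finset.sum_le_sum fun i' _ => ?_
      split_ifs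
      · simpa using mul_nonneg (edgeVal_nonneg (β i)) (edgeVal_nonneg (β i'))
      · rw [mul_pow, pow_two, pow_two, edgeVal_mul_self, edgeVal_mul_self]
    · rw [mul_pow, pow_two (edgeVal _), edgeVal_mul_self]
  refine (Finset.sum_le_sum fun i _ => h i).trans_eq ?_
  rw [← Finset.sum_mul, ← rowDegree]
  ring

/-- A variance proxy: the squared largest row degree times the largest column degree. -/
noncomputable def degreeProxy {n m : ℕ} (b : Fin m → Fin n → Bool) : ℝ :=
  (⨆ j, rowDegree (b j)) ^ 2 * ⨆ i, colDegree b i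

lemma degreeProxy_nonneg {n m : ℕ} (b : Fin m → Fin n → Bool) : 0 ≤ degreeProxy b :=
  mul_nonneg (sq_nonneg _) (Real.iSup_nonneg fun i => colDegree_nonneg b i)

lemma sum_rowGram_mulVec_sq_le {n m : ℕ} (b : Fin m → Fin n → Bool) (u : Fin n → ℝ) :
    ∑ j, (rowGram (b j) *ᵥ u) ⬝ᵥ (rowGram (b j) *ᵥ u) ≤ degreeProxy b * (u ⬝ᵥ u) := by
  set d := ⨆ j, rowDegree (b j) with hd
  set k := ⨆ i, colDegree b i with hk
  have hdj : ∀ j, rowDegree (b j) ≤ d := fun j =>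
    le_ciSup (f := fun j => rowDegree (b j)) (Set.finite_range _).bddAbove j
  have hki : ∀ i, colDegree b i ≤ k := fun i =>
    le_ciSup (f := fun i => colDegree b i) (Set.finite_range _).bddAbove i
  calc ∑ j, (rowGram (b j) *ᵥ u) ⬝ᵥ (rowGram (b j) *ᵥ u)
      ≤ ∑ j, d ^ 2 * ∑ i, edgeVal (b j i) * u i ^ 2 := by
        refine Finset.sum_le_sum fun j _ => (rowGram_mulVec_sq_le _ _).trans ?_
        refine mul_le_mul_of_nonneg_right
          (pow_le_pow_left₀ (rowDegree_nonneg _) (hdj j) 2) ?_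
        exact Finset.sum_nonneg fun i' _ => mul_nonneg (edgeVal_nonneg _) (sq_nonneg _)
    _ = d ^ 2 * ∑ i, colDegree b i * u i ^ 2 := by
        rw [← Finset.mul_sum, Finset.sum_comm]
        simp only [colDegree, Finset.sum_mul]
    _ ≤ d ^ 2 * ∑ i, k * u i ^ 2 := by
        gcongr with i _
        exact hki i
    _ = _ := by
        rw [← Finset.mul_sum, degreeProxy]
        simp only [dotProduct, ← pow_two]
        ring

lemma iSup_pow_le_sum {α : Type*} [Fintype α] {f : α → ℝ} (hf : ∀ a, 0 ≤ f a) {p : ℕ}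
    (hp : p ≠ 0) : (⨆ a, f a) ^ p ≤ ∑ a, f a ^ p := by
  rcases isEmpty_or_nonempty α with h | h
  -- The supremum over an empty family is `0`, and `p ≠ 0` makes its power equal to the empty sum.
  · simp [hp]
  · obtain ⟨a, ha⟩ := exists_eq_ciSup_of_finite (f := f)
    rw [← ha]
    exact Finset.single_le_sum (f := fun a => f a ^ p) (fun a _ => pow_nonneg (hf a) p)
      (Finset.mem_univ a)

lemma pow_le_pow_mul_exp {x : ℝ} (hx : 0 ≤ x) {k l : ℕ} (hkl : k ≤ l) :
    x ^ k ≤ (l : ℝ) ^ l * Real.exp x := by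
  have h := Real.pow_div_factorial_le_exp x hx k
  rw [div_le_iff₀ (by positivity)] at h
  have h2 : ((k.factorial : ℕ) : ℝ) ≤ (l : ℝ) ^ l := by
    exact_mod_cast (Nat.factorial_le hkl).trans (Nat.factorial_le_pow l)
  calc x ^ k ≤ Real.exp x * k.factorial := h
    _ ≤ Real.exp x * (l : ℝ) ^ l := by gcongr
    _ = _ := mul_comm _ _

/-- Maxima are replaced by sums of high powers, and powers by exponentials. The scale `s`, later
`n/m`, normalises column degrees, whose mean is at most `m/n`, to order one. -/
lemma degreeProxy_pow_le {n m : ℕ} (b : Fin m → Fin n → Bool) {s : ℝ} (hs : 0 < s) {p : ℕ}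
    (hp : p ≠ 0) :
    degreeProxy b ^ p ≤ (s⁻¹) ^ p * (((4 * p : ℕ) : ℝ) ^ (4 * p) *
      (∑ j, Real.exp (rowDegree (b j)) + ∑ i, Real.exp (s * colDegree b i))) := by
  set d := ⨆ j, rowDegree (b j) with hd
  set k := ⨆ i, colDegree b i with hk
  have hd0 : 0 ≤ d := Real.iSup_nonneg fun j => rowDegree_nonneg _
  have hk0 : 0 ≤ k := Real.iSup_nonneg fun j => colDegree_nonneg _ _
  have h1 : d ^ (4 * p) ≤ ((4 * p : ℕ) : ℝ) ^ (4 * p) * ∑ j, Real.exp (rowDegree (b j)) := by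
    refine (iSup_pow_le_sum (fun j => rowDegree_nonneg (b j)) (by omega)).trans ?_
    rw [Finset.mul_sum]
    exact Finset.sum_le_sum fun j _ => pow_le_pow_mul_exp (rowDegree_nonneg _) le_rfl
  have h2 : (s * k) ^ (2 * p) ≤
      ((4 * p : ℕ) : ℝ) ^ (4 * p) * ∑ i, Real.exp (s * colDegree b i) := by
    rw [mul_pow]
    refine (mul_le_mul_of_nonneg_left
      (iSup_pow_le_sum (fun i => colDegree_nonneg b i) (by omega)) (by positivity)).trans ?_
    rw [Finset.mul_sum, Finset.mul_sum]
    refine Finset.sum_le_sum fun i _ => ?_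
    rw [← mul_pow]
    exact pow_le_pow_mul_exp (mul_nonneg hs.le (colDegree_nonneg _ _)) (by omega)
  have h3 : degreeProxy b ^ p = (s⁻¹) ^ p * ((d ^ (2 * p)) * (s * k) ^ p) := by
    have : degreeProxy b = s⁻¹ * (d ^ 2 * (s * k)) := by
      rw [degreeProxy, ← hd, ← hk]; field_simp
    rw [this, mul_pow, mul_pow, pow_mul]
  -- Decoupling the two maxima avoids any joint moment of row and column degrees.
  have h4 : d ^ (2 * p) * (s * k) ^ p ≤ d ^ (4 * p) + (s * k) ^ (2 * p) := by
    have e1 : d ^ (4 * p) = (d ^ (2 * p)) ^ 2 := by ring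
    have e2 : (s * k) ^ (2 * p) = ((s * k) ^ p) ^ 2 := by ring
    rw [e1, e2]
    nlinarith [sq_nonneg (d ^ (2 * p) - (s * k) ^ p), sq_nonneg (d ^ (2 * p)),
      sq_nonneg ((s * k) ^ p)]
  rw [h3]
  refine mul_le_mul_of_nonneg_left ?_ (by positivity)
  linarith

lemma exp_two_le_eight : Real.exp 2 ≤ 8 := by
  have h := Real.exp_one_lt_d9
  have e : Real.exp 2 = Real.exp 1 * Real.exp 1 := by rw [← Real.exp_add]; norm_num
  rw [e]
  nlinarith [Real.exp_pos 1]

lemma sum_degreeProxy_pow_le {n m : ℕ} (hn : 0 < n) (hnm : n ≤ m) {q : (Fin n → Bool) → ℝ}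
    (hq0 : ∀ β, 0 ≤ q β) (hq : ∑ β, q β = 1)
    (hrow : ∑ β, q β * Real.exp (rowDegree β) ≤ 8)
    (hcol : ∀ i, ∀ s : ℝ, 0 ≤ s → s ≤ 1 →
      ∑ β, q β * Real.exp (s * edgeVal (β i)) ≤ 1 + 2 * s / n) {p : ℕ} (hp : p ≠ 0) :
    ∑ b : Fin m → Fin n → Bool, prodWeight q b * degreeProxy b ^ p ≤
      ((m : ℝ) / n) ^ p * (((4 * p : ℕ) : ℝ) ^ (4 * p) * (8 * (n + m))) := by
  have hn' : (0 : ℝ) < n := by exact_mod_cast hn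
  have hm' : (0 : ℝ) < m := by exact_mod_cast hn.trans_le hnm
  have hnm' : (n : ℝ) ≤ m := by exact_mod_cast hnm
  have hs : 0 < (n : ℝ) / m := by positivity
  have h1 : ∀ j : Fin m, ∑ b : Fin m → Fin n → Bool,
      prodWeight q b * Real.exp (rowDegree (b j)) ≤ 8 := fun j => by
    rw [sum_prodWeight_mul_apply hq j fun β => Real.exp (rowDegree β)]
    exact hrow
  have h2 : ∀ i : Fin n, ∑ b : Fin m → Fin n → Bool,
      prodWeight q b * Real.exp ((n : ℝ) / m * colDegree b i) ≤ 8 := fun i => by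
    have e : ∀ b : Fin m → Fin n → Bool, Real.exp ((n : ℝ) / m * colDegree b i) =
        ∏ j, Real.exp ((n : ℝ) / m * edgeVal (b j i)) := fun b => by
      rw [colDegree, Finset.mul_sum, Real.exp_sum]
    simp only [e]
    rw [sum_prodWeight_mul_prod q fun _ β => Real.exp ((n : ℝ) / m * edgeVal (β i)),
      Finset.prod_const, Finset.card_univ, Fintype.card_fin]
    -- The `m` rows are independent, so the column moment is at most `(1 + 2/m)^m ≤ e²`.
    have h := hcol i ((n : ℝ) / m) hs.le (div_le_one_of_le₀ hnm' hm'.le)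
    have e2 : 2 * ((n : ℝ) / m) / n = 2 / m := by field_simp
    rw [e2] at h
    have h3 : (1 : ℝ) + 2 / m ≤ Real.exp (2 / m) := by
      rw [add_comm]; exact Real.add_one_le_exp _
    calc _ ≤ Real.exp (2 / m) ^ m := pow_le_pow_left₀
          (Finset.sum_nonneg fun β _ => mul_nonneg (hq0 β) (Real.exp_pos _).le) (h.trans h3) m
      _ = Real.exp 2 := by rw [← Real.exp_nat_mul]; congr 1; field_simp
      _ ≤ 8 := exp_two_le_eight
  calc ∑ b : Fin m → Fin n → Bool, prodWeight q b * degreeProxy b ^ p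
      ≤ ∑ b : Fin m → Fin n → Bool, prodWeight q b * (((m : ℝ) / n) ^ p *
        (((4 * p : ℕ) : ℝ) ^ (4 * p) * (∑ j, Real.exp (rowDegree (b j)) +
          ∑ i, Real.exp ((n : ℝ) / m * colDegree b i)))) := by
        refine Finset.sum_le_sum fun b _ =>
          mul_le_mul_of_nonneg_left ?_ (prodWeight_nonneg hq0 b)
        have := degreeProxy_pow_le b hs hp
        rwa [inv_div] at this
    _ = ((m : ℝ) / n) ^ p * (((4 * p : ℕ) : ℝ) ^ (4 * p) *
        (∑ j, ∑ b : Fin m → Fin n → Bool, prodWeight q b * Real.exp (rowDegree (b j)) +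
          ∑ i, ∑ b : Fin m → Fin n → Bool,
            prodWeight q b * Real.exp ((n : ℝ) / m * colDegree b i))) := by
        rw [Finset.sum_comm (s := (Finset.univ : Finset (Fin m))),
          Finset.sum_comm (s := (Finset.univ : Finset (Fin n))), ← Finset.sum_add_distrib,
          Finset.mul_sum, Finset.mul_sum]
        refine Finset.sum_congr rfl fun b _ => ?_
        rw [← Finset.mul_sum, ← Finset.mul_sum]
        ring
    _ ≤ ((m : ℝ) / n) ^ p * (((4 * p : ℕ) : ℝ) ^ (4 * p) *
        (∑ _j : Fin m, 8 + ∑ _i : Fin n, 8)) := by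
        gcongr with j _ i _
        · exact h1 j
        · exact h2 i
    _ = _ := by
        simp only [Finset.sum_const, Finset.card_univ, Fintype.card_fin, nsmul_eq_mul]
        ring

/-- A trace moment bound for the centred co-occurrence matrix of independent rows. -/
theorem sum_trace_rowGram_pow_le {n m : ℕ} (hn : 0 < n) (hnm : n ≤ m)
    {q : (Fin n → Bool) → ℝ}
    (hq0 : ∀ β, 0 ≤ q β) (hq : ∑ β, q β = 1)
    (hrow : ∑ β, q β * Real.exp (rowDegree β) ≤ 8)
    (hcol : ∀ i, ∀ s : ℝ, 0 ≤ s → s ≤ 1 →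
      ∑ β, q β * Real.exp (s * edgeVal (β i)) ≤ 1 + 2 * s / n)
    {K : Matrix (Fin n) (Fin n) ℝ} (hK : K.IsSymm) (hmean : ∑ β, q β • rowGram β = K)
    {p : ℕ} (hp : p ≠ 0) :
    ∑ b : Fin m → Fin n → Bool, prodWeight q b * (centredSum rowGram K b ^ (2 * p)).trace ≤
      16 * n * (n + m) * (2048 * p ^ 5 * ((m : ℝ) / n)) ^ p := by
  obtain ⟨r, rfl⟩ := Nat.exists_eq_succ_of_ne_zero hp
  refine (sum_trace_centredSum_pow_le hq0 hq rowGram_isSymm hK hmean degreeProxy_nonneg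
    sum_rowGram_mulVec_sq_le r).trans ?_
  set p := r + 1 with hpr
  have hpr' : ((r.succ : ℕ) : ℝ) = r + 1 := by push_cast; ring
  rw [hpr']
  have hmom := sum_degreeProxy_pow_le hn hnm hq0 hq hrow hcol hp
  rw [Nat.succ_eq_add_one, ← hpr] at hmom
  -- The factor `8 (r + 1)` combines `2 (2r + 1) ≤ 4 (r + 1)` with the `2` per power lost in
  -- splitting the sum.
  have hz : ∀ z : (Fin m → Fin n → Bool) × (Fin m → Fin n → Bool),
      ((2 * r + 1 : ℝ) * (2 * (degreeProxy z.1 + degreeProxy z.2))) ^ p ≤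
      (8 * (r + 1 : ℝ)) ^ p * (degreeProxy z.1 ^ p + degreeProxy z.2 ^ p) := by
    intro z
    have h1 := degreeProxy_nonneg z.1
    have h2 := degreeProxy_nonneg z.2
    have h3 : (degreeProxy z.1 + degreeProxy z.2) ^ p ≤
        2 ^ p * (degreeProxy z.1 ^ p + degreeProxy z.2 ^ p) := by
      refine (add_pow_le h1 h2 p).trans ?_
      gcongr
      · norm_num
      · omega
    calc ((2 * r + 1 : ℝ) * (2 * (degreeProxy z.1 + degreeProxy z.2))) ^ p
        ≤ ((4 * (r + 1 : ℝ)) * (degreeProxy z.1 + degreeProxy z.2)) ^ p := by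
          refine pow_le_pow_left₀ (by positivity) ?_ p
          nlinarith
      _ ≤ (4 * (r + 1 : ℝ)) ^ p * (2 ^ p * (degreeProxy z.1 ^ p + degreeProxy z.2 ^ p)) := by
          rw [mul_pow]; gcongr
      _ = _ := by rw [← mul_assoc, ← mul_pow]; congr 2; ring
  have hsum : ∑ z : (Fin m → Fin n → Bool) × (Fin m → Fin n → Bool),
      prodWeight q z.1 * prodWeight q z.2 *
        ((2 * r + 1 : ℝ) * (2 * (degreeProxy z.1 + degreeProxy z.2))) ^ p ≤
      (8 * (r + 1 : ℝ)) ^ p * (2 * (((m : ℝ) / n) ^ p *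
        (((4 * p : ℕ) : ℝ) ^ (4 * p) * (8 * (n + m))))) := by
    calc _ ≤ ∑ z : (Fin m → Fin n → Bool) × (Fin m → Fin n → Bool),
          prodWeight q z.1 * prodWeight q z.2 *
            ((8 * (r + 1 : ℝ)) ^ p * (degreeProxy z.1 ^ p + degreeProxy z.2 ^ p)) :=
          Finset.sum_le_sum fun z _ => mul_le_mul_of_nonneg_left (hz z)
            (mul_nonneg (prodWeight_nonneg hq0 _) (prodWeight_nonneg hq0 _))
      _ = (8 * (r + 1 : ℝ)) ^ p *
          (∑ z : (Fin m → Fin n → Bool) × (Fin m → Fin n → Bool),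
            prodWeight q z.1 * prodWeight q z.2 * degreeProxy z.1 ^ p +
          ∑ z : (Fin m → Fin n → Bool) × (Fin m → Fin n → Bool),
            prodWeight q z.1 * prodWeight q z.2 * degreeProxy z.2 ^ p) := by
          rw [← Finset.sum_add_distrib, Finset.mul_sum]
          exact Finset.sum_congr rfl fun z _ => by ring
      _ ≤ _ := by
          rw [sum_pair_fst hq fun b : Fin m → Fin n → Bool => degreeProxy b ^ p,
            sum_pair_snd hq fun b : Fin m → Fin n → Bool => degreeProxy b ^ p, ← two_mul]
          gcongr
  rw [Fintype.card_fin]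
  calc _ ≤ (n : ℝ) * ((8 * (r + 1 : ℝ)) ^ p * (2 * (((m : ℝ) / n) ^ p *
        (((4 * p : ℕ) : ℝ) ^ (4 * p) * (8 * (n + m)))))) := by gcongr
    _ = 16 * n * (n + m) * ((8 * (r + 1 : ℝ)) ^ p * ((((4 * p : ℕ) : ℝ) ^ 4) ^ p *
          ((m : ℝ) / n) ^ p)) := by
        rw [pow_mul]; ring
    -- Here `2048 p⁵ = 8 p · (4p)⁴`.
    _ = _ := by
        rw [← mul_pow, ← mul_pow]
        congr 2
        rw [hpr]; push_cast; ring

open Classical in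
/-- The Markov inequality for the spectral norm through an even trace moment. -/
lemma sum_prodWeight_specNorm_gt_le {n m p : ℕ} (hp : p ≠ 0) {q : (Fin n → Bool) → ℝ}
    (hq0 : ∀ β, 0 ≤ q β) {K : Matrix (Fin n) (Fin n) ℝ} (hK : K.IsSymm) {t R : ℝ} (ht : 0 < t)
    (hR : ∑ b : Fin m → Fin n → Bool,
      prodWeight q b * (centredSum rowGram K b ^ (2 * p)).trace ≤ R)
    (P : (Fin m → Fin n → Bool) → Prop)
    (hP : ∀ b, P b → t < specNorm (centredSum rowGram K b)) :
    ∑ b : Fin m → Fin n → Bool, (if P b then prodWeight q b else 0) ≤ R / t ^ (2 * p) := by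
  rw [le_div_iff₀ (by positivity), Finset.sum_mul]
  refine le_trans (Finset.sum_le_sum fun b _ => ?_) hR
  have hsym := centredSum_isSymm rowGram_isSymm hK b
  split_ifs with h
  · refine mul_le_mul_of_nonneg_left ?_ (prodWeight_nonneg hq0 b)
    by_contra hlt
    exact absurd (specNorm_le_of_trace_pow_le hp hsym ht.le (not_le.1 hlt).le) (not_le.2 (hP b h))
  · rw [zero_mul]
    exact mul_nonneg (prodWeight_nonneg hq0 b) (trace_pow_two_mul_nonneg hsym p)

/-! ### Regularity of the kernels and the law of one row given the influencers. -/

lemma kernel_comm (c₀ c₁ Δ : ℝ) (x y : I) : kernel c₀ c₁ Δ x y = kernel c₀ c₁ Δ y x := by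
  rw [kernel, kernel, abs_sub_comm]

lemma continuous_kernel {c₀ c₁ Δ : ℝ} (h₁ : 0 < c₁) (hΔ : 0 ≤ Δ) :
    Continuous fun p : I × I => kernel c₀ c₁ Δ p.1 p.2 := by
  unfold kernel
  refine Continuous.div continuous_const ?_ fun p => ?_
  · exact (Continuous.rpow_const (by fun_prop) fun p => Or.inr hΔ).add continuous_const
  · have : 0 ≤ |(p.1 : ℝ) - (p.2 : ℝ)| ^ Δ := by positivity
    linarith

lemma integrable_of_continuous {X : Type*} [TopologicalSpace X] [CompactSpace X]
    [MeasurableSpace X] [OpensMeasurableSpace X] {μ : Measure X} [IsFiniteMeasure μ]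
    {f : X → ℝ} (hf : Continuous f) : Integrable f μ :=
  hf.integrable_of_hasCompactSupport (HasCompactSupport.of_compactSpace f)

lemma sqKernel_comm (c₀ c₁ Δ : ℝ) (D : Measure I) (x x' : I) :
    sqKernel c₀ c₁ Δ D x x' = sqKernel c₀ c₁ Δ D x' x := by
  unfold sqKernel
  congr 1
  ext z
  rw [mul_comm, kernel_comm _ _ _ z x', kernel_comm _ _ _ x z]

lemma sqKernel_mem_Icc {c₀ c₁ Δ : ℝ} (h₀ : 0 < c₀) (h₁ : c₀ ≤ c₁) (D : Measure I)
    [IsProbabilityMeasure D] (x x' : I) : sqKernel c₀ c₁ Δ D x x' ∈ Set.Icc (0 : ℝ) 1 := by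
  have h : ∀ z, 0 ≤ kernel c₀ c₁ Δ x z * kernel c₀ c₁ Δ z x' ∧
      kernel c₀ c₁ Δ x z * kernel c₀ c₁ Δ z x' ≤ 1 := fun z => by
    have h1 := kernel_mem c₀ c₁ Δ h₀ h₁ x z
    have h2 := kernel_mem c₀ c₁ Δ h₀ h₁ z x'
    exact ⟨mul_nonneg h1.1.le h2.1.le, mul_le_one₀ h1.2 h2.1.le h2.2⟩
  refine ⟨integral_nonneg fun z => (h z).1, ?_⟩
  refine (integral_mono_of_nonneg (Filter.Eventually.of_forall fun z => (h z).1)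
    (integrable_const (1 : ℝ)) (Filter.Eventually.of_forall fun z => (h z).2)).trans_eq ?_
  simp

lemma continuous_sqKernel {c₀ c₁ Δ : ℝ} (h₁ : 0 < c₁) (hΔ : 0 ≤ Δ) (D : Measure I)
    [IsProbabilityMeasure D] : Continuous fun p : I × I => sqKernel c₀ c₁ Δ D p.1 p.2 := by
  have hk := continuous_kernel (c₀ := c₀) h₁ hΔ
  have hf : Continuous (Function.uncurry fun (p : I × I) (z : I) =>
      kernel c₀ c₁ Δ p.1 z * kernel c₀ c₁ Δ z p.2) :=
    (hk.comp (f := fun w : (I × I) × I => (w.1.1, w.2)) (by fun_prop)).mul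
      (hk.comp (f := fun w : (I × I) × I => (w.2, w.1.2)) (by fun_prop))
  have := continuous_parametric_integral_of_continuous (μ := D) hf isCompact_univ
  simpa [sqKernel] using this

/-- The probability of the value `e` for the edge between a follower at `y` and an influencer
at `x`. -/
noncomputable def edgeWeight (c₀ c₁ Δ : ℝ) (n : ℕ) (y x : I) (e : Bool) : ℝ :=
  if e then kernel c₀ c₁ Δ y x / n else 1 - kernel c₀ c₁ Δ y x / n

lemma edgeWeight_nonneg {c₀ c₁ Δ : ℝ} (h₀ : 0 < c₀) (h₁ : c₀ ≤ c₁) (n : ℕ) (y x : I) (e : Bool) :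
    0 ≤ edgeWeight c₀ c₁ Δ n y x e := by
  have h := (edgeProb c₀ c₁ Δ n y x).2
  rw [coe_edgeProb c₀ c₁ Δ h₀ h₁] at h
  cases e
  · simpa [edgeWeight] using h.2
  · simpa [edgeWeight] using h.1

lemma bernoulliMeasure_singleton_eq {c₀ c₁ Δ : ℝ} (h₀ : 0 < c₀) (h₁ : c₀ ≤ c₁) (n : ℕ) (y x : I)
    (e : Bool) : bernoulliMeasure true false (edgeProb c₀ c₁ Δ n y x) {e} =
      ENNReal.ofReal (edgeWeight c₀ c₁ Δ n y x e) := by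
  rw [← ofReal_measureReal]
  congr 1
  cases e
  · rw [bernoulliMeasure_real_apply_of_notMem_of_mem _ (measurableSet_singleton _) (by simp)
      (by simp), coe_edgeProb c₀ c₁ Δ h₀ h₁]
    simp [edgeWeight]
  · rw [bernoulliMeasure_real_apply_of_mem_of_notMem _ (measurableSet_singleton _) (by simp)
      (by simp), coe_edgeProb c₀ c₁ Δ h₀ h₁]
    simp [edgeWeight]

lemma continuous_edgeWeight {c₀ c₁ Δ : ℝ} (h₁ : 0 < c₁) (hΔ : 0 ≤ Δ) (n : ℕ) (x : I) (e : Bool) :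
    Continuous fun y => edgeWeight c₀ c₁ Δ n y x e := by
  have hk : Continuous fun y => kernel c₀ c₁ Δ y x :=
    (continuous_kernel (c₀ := c₀) h₁ hΔ).comp (f := fun y : I => (y, x)) (by fun_prop)
  cases e
  · simp only [edgeWeight, Bool.false_eq_true, if_false]
    exact continuous_const.sub (hk.div_const _)
  · simpa [edgeWeight] using hk.div_const _

/-- The probability that a follower has the row `β` of edges, given the positions `x` of the
influencers. -/
noncomputable def rowWeight (c₀ c₁ Δ : ℝ) (D : Measure I) {n : ℕ} (x : Fin n → I)
    (β : Fin n → Bool) : ℝ :=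
  ∫ y, ∏ i, edgeWeight c₀ c₁ Δ n y (x i) (β i) ∂D

section RowWeight

variable {c₀ c₁ Δ : ℝ} {n : ℕ}

lemma rowWeight_nonneg (h₀ : 0 < c₀) (h₁ : c₀ ≤ c₁) (D : Measure I) (x : Fin n → I)
    (β : Fin n → Bool) : 0 ≤ rowWeight c₀ c₁ Δ D x β :=
  integral_nonneg fun _ => Finset.prod_nonneg fun _ _ => edgeWeight_nonneg h₀ h₁ _ _ _ _

/-- Given the follower's position `y` the edges are independent, so a product test function averages
factor by factor under the integral. Total mass, exponential moments and the mean of `rowGram` are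
all instances. -/
lemma sum_rowWeight_mul_prod (h₀ : 0 < c₀) (h₁ : c₀ ≤ c₁) (hΔ : 0 ≤ Δ) (D : Measure I)
    [IsProbabilityMeasure D] (x : Fin n → I) (f : Fin n → Bool → ℝ) :
    ∑ β, rowWeight c₀ c₁ Δ D x β * ∏ i, f i (β i) =
      ∫ y, ∏ i, (kernel c₀ c₁ Δ y (x i) / n * f i true +
        (1 - kernel c₀ c₁ Δ y (x i) / n) * f i false) ∂D := by
  have hc : ∀ β : Fin n → Bool, Continuous fun y => ∏ i, edgeWeight c₀ c₁ Δ n y (x i) (β i) :=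
    fun β => continuous_finsetProd _ fun i _ =>
      continuous_edgeWeight (h₀.trans_le h₁) hΔ n (x i) (β i)
  have e : ∀ y, ∏ i, (kernel c₀ c₁ Δ y (x i) / n * f i true +
        (1 - kernel c₀ c₁ Δ y (x i) / n) * f i false) =
      ∑ β : Fin n → Bool, (∏ i, edgeWeight c₀ c₁ Δ n y (x i) (β i)) * ∏ i, f i (β i) := by
    intro y
    have h2 : ∀ i, kernel c₀ c₁ Δ y (x i) / n * f i true +
        (1 - kernel c₀ c₁ Δ y (x i) / n) * f i false =
        ∑ e : Bool, edgeWeight c₀ c₁ Δ n y (x i) e * f i e := fun i => by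
      simp [edgeWeight]
    simp only [h2]
    rw [Finset.prod_univ_sum, Fintype.piFinset_univ]
    simp only [Finset.prod_mul_distrib]
  simp only [e]
  rw [integral_finsetSum _ fun β _ => (integrable_of_continuous (hc β)).mul_const _]
  exact Finset.sum_congr rfl fun β _ => by rw [integral_mul_const, rowWeight]

lemma sum_rowWeight (h₀ : 0 < c₀) (h₁ : c₀ ≤ c₁) (hΔ : 0 ≤ Δ) (D : Measure I)
    [IsProbabilityMeasure D] (x : Fin n → I) : ∑ β, rowWeight c₀ c₁ Δ D x β = 1 := by
  have h := sum_rowWeight_mul_prod h₀ h₁ hΔ D x fun _ _ => 1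
  simpa using h

/-- Each of the `n` factors is at most `1 + (e - 1)/n ≤ exp (2/n)`, whatever `y` is. -/
lemma sum_rowWeight_exp_rowDegree_le (h₀ : 0 < c₀) (h₁ : c₀ ≤ c₁) (hΔ : 0 ≤ Δ) (D : Measure I)
    [IsProbabilityMeasure D] (hn : 0 < n) (x : Fin n → I) :
    ∑ β, rowWeight c₀ c₁ Δ D x β * Real.exp (rowDegree β) ≤ 8 := by
  have hn' : (0 : ℝ) < n := by exact_mod_cast hn
  have h := sum_rowWeight_mul_prod h₀ h₁ hΔ D x fun _ e => Real.exp (edgeVal e)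
  simp only [← Real.exp_sum] at h
  simp only [rowDegree]
  rw [h]
  have he : Real.exp 1 ≤ 3 := Real.exp_one_lt_d9.le.trans (by norm_num)
  have he1 : 1 ≤ Real.exp 1 := Real.one_le_exp zero_le_one
  have hb : ∀ y, ∀ i, 0 ≤ kernel c₀ c₁ Δ y (x i) / n * Real.exp (edgeVal true) +
        (1 - kernel c₀ c₁ Δ y (x i) / n) * Real.exp (edgeVal false) ∧
      kernel c₀ c₁ Δ y (x i) / n * Real.exp (edgeVal true) +
        (1 - kernel c₀ c₁ Δ y (x i) / n) * Real.exp (edgeVal false) ≤ Real.exp (2 / n) := by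
    intro y i
    have hk := kernel_mem c₀ c₁ Δ h₀ h₁ y (x i)
    have hk0 : 0 ≤ kernel c₀ c₁ Δ y (x i) / n := div_nonneg hk.1.le hn'.le
    have hk1 : kernel c₀ c₁ Δ y (x i) / n ≤ 1 / n := div_le_div_of_nonneg_right hk.2 hn'.le
    have h3 : (2 : ℝ) / n + 1 ≤ Real.exp (2 / n) := Real.add_one_le_exp _
    have h4 : (2 : ℝ) / n = 2 * (1 / n) := by ring
    simp only [edgeVal, if_true, Bool.false_eq_true, if_false, Real.exp_zero, mul_one]
    constructor <;> nlinarith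
  refine (integral_mono_of_nonneg (Filter.Eventually.of_forall fun y =>
    Finset.prod_nonneg fun i _ => (hb y i).1) (integrable_const (8 : ℝ))
    (Filter.Eventually.of_forall fun y => ?_)).trans_eq (by simp)
  refine (Finset.prod_le_prod (fun i _ => (hb y i).1) fun i _ => (hb y i).2).trans ?_
  rw [Finset.prod_const, Finset.card_univ, Fintype.card_fin, ← Real.exp_nat_mul]
  have : (n : ℝ) * (2 / n) = 2 := by field_simp
  rw [this]
  exact exp_two_le_eight

lemma exp_le_one_add_two_mul {s : ℝ} (h0 : 0 ≤ s) (h1 : s ≤ 1) : Real.exp s ≤ 1 + 2 * s := by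
  have h := Real.abs_exp_sub_one_le (x := s) (by rwa [abs_of_nonneg h0])
  rw [abs_of_nonneg h0] at h
  linarith [le_abs_self (Real.exp s - 1)]

lemma sum_rowWeight_exp_edgeVal_le (h₀ : 0 < c₀) (h₁ : c₀ ≤ c₁) (hΔ : 0 ≤ Δ) (D : Measure I)
    [IsProbabilityMeasure D] (hn : 0 < n) (x : Fin n → I) (i : Fin n) {s : ℝ} (hs0 : 0 ≤ s)
    (hs1 : s ≤ 1) :
    ∑ β, rowWeight c₀ c₁ Δ D x β * Real.exp (s * edgeVal (β i)) ≤ 1 + 2 * s / n := by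
  have hn' : (0 : ℝ) < n := by exact_mod_cast hn
  have h := sum_rowWeight_mul_prod h₀ h₁ hΔ D x
    fun l e => if l = i then Real.exp (s * edgeVal e) else 1
  simp only [Finset.prod_ite_eq', Finset.mem_univ, if_true] at h
  rw [h]
  have e : ∀ y, ∏ l, (kernel c₀ c₁ Δ y (x l) / n * (if l = i then Real.exp (s * edgeVal true)
        else 1) + (1 - kernel c₀ c₁ Δ y (x l) / n) *
          (if l = i then Real.exp (s * edgeVal false) else 1)) =
      1 + kernel c₀ c₁ Δ y (x i) / n * (Real.exp s - 1) := by
    intro y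
    rw [Finset.prod_eq_single i]
    · simp [edgeVal]; ring
    · intro l _ hl
      simp [hl]
    · simp
  simp only [e]
  have hexp := exp_le_one_add_two_mul hs0 hs1
  have hexp1 : 1 ≤ Real.exp s := Real.one_le_exp hs0
  have hk : ∀ y, 0 ≤ kernel c₀ c₁ Δ y (x i) / n ∧ kernel c₀ c₁ Δ y (x i) / n ≤ 1 / n := fun y =>
    have hk := kernel_mem c₀ c₁ Δ h₀ h₁ y (x i)
    ⟨div_nonneg hk.1.le hn'.le, div_le_div_of_nonneg_right hk.2 hn'.le⟩
  refine (integral_mono_of_nonneg (Filter.Eventually.of_forall fun y => ?_)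
    (integrable_const (1 + 2 * s / n : ℝ))
    (Filter.Eventually.of_forall fun y => ?_)).trans_eq (by simp)
  · exact add_nonneg zero_le_one (mul_nonneg (hk y).1 (by linarith))
  · have : kernel c₀ c₁ Δ y (x i) / n * (Real.exp s - 1) ≤ 1 / n * (2 * s) :=
      mul_le_mul (hk y).2 (by linarith) (by linarith) (by positivity)
    have e2 : 2 * s / n = 1 / n * (2 * s) := by ring
    change 1 + _ ≤ 1 + 2 * s / n
    linarith

/-- The mean of `rowGram` given the positions of the influencers. -/
noncomputable def meanGram (c₀ c₁ Δ : ℝ) (D : Measure I) {n : ℕ} (x : Fin n → I) :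
    Matrix (Fin n) (Fin n) ℝ :=
  Matrix.of fun i i' => if i = i' then 0 else sqKernel c₀ c₁ Δ D (x i) (x i') / n ^ 2

lemma meanGram_isSymm (D : Measure I) (x : Fin n → I) : (meanGram c₀ c₁ Δ D x).IsSymm := by
  ext i i'
  simp only [meanGram, transpose_apply, of_apply, eq_comm (a := i'),
    sqKernel_comm _ _ _ _ (x i') (x i)]

lemma sum_rowWeight_smul_rowGram (h₀ : 0 < c₀) (h₁ : c₀ ≤ c₁) (hΔ : 0 ≤ Δ) (D : Measure I)
    [IsProbabilityMeasure D] (x : Fin n → I) :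
    ∑ β, rowWeight c₀ c₁ Δ D x β • rowGram β = meanGram c₀ c₁ Δ D x := by
  ext i i'
  rw [Matrix.sum_apply]
  by_cases hii : i = i'
  · simp [rowGram, meanGram, hii]
  have h := sum_rowWeight_mul_prod h₀ h₁ hΔ D x fun l e =>
    (if l = i then edgeVal e else 1) * (if l = i' then edgeVal e else 1)
  simp only [Finset.prod_mul_distrib, Finset.prod_ite_eq', Finset.mem_univ, if_true] at h
  have e : ∀ y, ∏ l, (kernel c₀ c₁ Δ y (x l) / n *
        ((if l = i then edgeVal true else 1) * (if l = i' then edgeVal true else 1)) +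
        (1 - kernel c₀ c₁ Δ y (x l) / n) *
        ((if l = i then edgeVal false else 1) * (if l = i' then edgeVal false else 1))) =
      (kernel c₀ c₁ Δ (x i) y * kernel c₀ c₁ Δ y (x i')) / n ^ 2 := by
    intro y
    have e1 : ∀ l, kernel c₀ c₁ Δ y (x l) / n *
        ((if l = i then edgeVal true else 1) * (if l = i' then edgeVal true else 1)) +
        (1 - kernel c₀ c₁ Δ y (x l) / n) *
        ((if l = i then edgeVal false else 1) * (if l = i' then edgeVal false else 1)) =
        (if l = i then kernel c₀ c₁ Δ y (x l) / n else 1) *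
          (if l = i' then kernel c₀ c₁ Δ y (x l) / n else 1) := by
      intro l
      by_cases hl : l = i
      · have hl' : l ≠ i' := fun h => hii (hl.symm.trans h)
        simp only [hl, hii, if_true, if_false, edgeVal]; simp
      · by_cases hl' : l = i'
        · subst hl'; simp [hl, edgeVal]
        · simp [hl, hl']
    simp only [e1, Finset.prod_mul_distrib, Finset.prod_ite_eq', Finset.mem_univ, if_true]
    rw [kernel_comm _ _ _ (x i) y]
    ring
  simp only [e] at h
  rw [integral_div] at h
  simp only [rowGram, meanGram, Matrix.smul_apply, of_apply, hii, if_false, smul_eq_mul]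
  exact h

lemma specNorm_diagonal_le {d : Fin n → ℝ} {t : ℝ} (ht : 0 ≤ t) (hd : ∀ i, |d i| ≤ t) :
    specNorm (diagonal d) ≤ t := by
  refine ContinuousLinearMap.opNorm_le_bound _ ht fun u => ?_
  refine (sq_le_sq₀ (norm_nonneg _) (by positivity)).1 ?_
  rw [mul_pow, EuclideanSpace.real_norm_sq_eq, EuclideanSpace.real_norm_sq_eq, Finset.mul_sum]
  refine Finset.sum_le_sum fun i _ => ?_
  have e : (Matrix.toEuclideanCLM (n := Fin n) (𝕜 := ℝ) (diagonal d) u) i = d i * u i := by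
    simp [mulVec_diagonal]
  rw [e, mul_pow]
  exact mul_le_mul_of_nonneg_right (sq_le_sq' (by linarith [neg_abs_le (d i), hd i])
    ((le_abs_self _).trans (hd i))) (sq_nonneg _)

/-- Off the diagonal, `m` copies of `meanGram` scaled by `n/m` give exactly `M / n`. The term `1 /
n` pays for the diagonal of `M`, which `A` lacks. -/
lemma specNorm_deviation_le (h₀ : 0 < c₀) (h₁ : c₀ ≤ c₁) (D : Measure I)
    [IsProbabilityMeasure D] {m : ℕ} (hn : 0 < n) (hm : 0 < m) (x : Fin n → I)
    (b : Fin m → Fin n → Bool) :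
    specNorm (((n : ℝ) / m) • coMatrix b - (1 / (n : ℝ)) • gramMatrix c₀ c₁ Δ D x) ≤
      (n : ℝ) / m * specNorm (centredSum rowGram (meanGram c₀ c₁ Δ D x) b) + 1 / n := by
  have hn' : (0 : ℝ) < n := by exact_mod_cast hn
  have hm' : (0 : ℝ) < m := by exact_mod_cast hm
  have e : ((n : ℝ) / m) • coMatrix b - (1 / (n : ℝ)) • gramMatrix c₀ c₁ Δ D x =
      ((n : ℝ) / m) • centredSum rowGram (meanGram c₀ c₁ Δ D x) b -
        diagonal fun i => sqKernel c₀ c₁ Δ D (x i) (x i) / n := by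
    rw [coMatrix_eq_sum_rowGram, centredSum, Finset.sum_sub_distrib, smul_sub, sub_sub]
    congr 1
    rw [Finset.sum_const, Finset.card_univ, Fintype.card_fin, ← Nat.cast_smul_eq_nsmul ℝ]
    ext i i'
    simp only [Matrix.add_apply, Matrix.smul_apply, gramMatrix, meanGram, of_apply, smul_eq_mul]
    by_cases hii : i = i'
    · subst hii; simp; ring
    · simp [hii]; field_simp
  rw [e, specNorm, map_sub, map_smul]
  refine (norm_sub_le _ _).trans ?_
  rw [norm_smul, Real.norm_of_nonneg (by positivity)]
  refine add_le_add le_rfl (specNorm_diagonal_le (by positivity) fun i => ?_)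
  have h := sqKernel_mem_Icc (Δ := Δ) h₀ h₁ D (x i) (x i)
  rw [abs_of_nonneg (div_nonneg h.1 hn'.le)]
  exact div_le_div_of_nonneg_right h.2 hn'.le

end RowWeight

/-! ### From the joint law to independent rows. -/

section Law

variable {c₀ c₁ Δ : ℝ} {n m : ℕ}

open Classical in
lemma edgeMeasure_eq_ofReal (h₀ : 0 < c₀) (h₁ : c₀ ≤ c₁) (p : (Fin n → I) × (Fin m → I))
    (s : Set (Fin m → Fin n → Bool)) :
    edgeMeasure c₀ c₁ Δ n m p s = ENNReal.ofReal (∑ b, if b ∈ s then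
      ∏ j, ∏ i, edgeWeight c₀ c₁ Δ n (p.2 j) (p.1 i) (b j i) else 0) := by
  have hnn : ∀ b : Fin m → Fin n → Bool,
      0 ≤ ∏ j, ∏ i, edgeWeight c₀ c₁ Δ n (p.2 j) (p.1 i) (b j i) := fun b =>
    Finset.prod_nonneg fun j _ => Finset.prod_nonneg fun i _ => edgeWeight_nonneg h₀ h₁ _ _ _ _
  conv_lhs => rw [← s.toFinite.coe_toFinset, ← sum_measure_singleton]
  rw [← Finset.sum_filter, ENNReal.ofReal_sum_of_nonneg fun b _ => hnn b]
  have hs : s.toFinite.toFinset = Finset.univ.filter (· ∈ s) := by ext; simp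
  rw [hs]
  refine Finset.sum_congr rfl fun b _ => ?_
  simp only [edgeMeasure, Measure.pi_singleton, bernoulliMeasure_singleton_eq h₀ h₁]
  rw [ENNReal.ofReal_prod_of_nonneg fun j _ => Finset.prod_nonneg fun i _ =>
    edgeWeight_nonneg h₀ h₁ _ _ _ _]
  refine Finset.prod_congr rfl fun j _ => ?_
  rw [ENNReal.ofReal_prod_of_nonneg fun i _ => edgeWeight_nonneg h₀ h₁ _ _ _ _]

open Classical in
-- The weight of an edge configuration is a product over followers, each factor depending on one `y
-- j`. Integrating over the independent `y j` therefore leaves i.i.d. rows.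
lemma lintegral_edgeMeasure (h₀ : 0 < c₀) (h₁ : c₀ ≤ c₁) (hΔ : 0 ≤ Δ) (D : Measure I)
    [IsProbabilityMeasure D] (x : Fin n → I) (s : Set (Fin m → Fin n → Bool)) :
    ∫⁻ y, edgeMeasure c₀ c₁ Δ n m (x, y) s ∂(Measure.pi fun _ => D) =
      ENNReal.ofReal (∑ b, if b ∈ s then prodWeight (rowWeight c₀ c₁ Δ D x) b else 0) := by
  simp only [edgeMeasure_eq_ofReal h₀ h₁]
  have hc : ∀ b : Fin m → Fin n → Bool, Continuous fun y : Fin m → I =>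
      if b ∈ s then ∏ j, ∏ i, edgeWeight c₀ c₁ Δ n (y j) (x i) (b j i) else 0 := by
    intro b
    split_ifs
    · exact continuous_finsetProd _ fun j _ => continuous_finsetProd _ fun i _ =>
        (continuous_edgeWeight (h₀.trans_le h₁) hΔ n (x i) (b j i)).comp (continuous_apply j)
    · exact continuous_const
  rw [← ofReal_integral_eq_lintegral_ofReal
    (integrable_of_continuous (continuous_finsetSum _ fun b _ => hc b))]
  · congr 1
    rw [integral_finsetSum _ fun b _ => integrable_of_continuous (hc b)]
    refine Finset.sum_congr rfl fun b _ => ?_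
    split_ifs
    · exact integral_fintype_prod_eq_prod (𝕜 := ℝ) (μ := fun _ : Fin m => D)
        (fun j y => ∏ i, edgeWeight c₀ c₁ Δ n y (x i) (b j i))
    · simp
  · refine Filter.Eventually.of_forall fun y => Finset.sum_nonneg fun b _ => ?_
    split_ifs
    · exact Finset.prod_nonneg fun j _ => Finset.prod_nonneg fun i _ =>
        edgeWeight_nonneg h₀ h₁ _ _ _ _
    · exact le_rfl

open Classical in
/-- A bound on the conditional probability given the positions of the influencers, in terms of
independent rows, bounds the probability under the joint law. -/
lemma law_real_le (h₀ : 0 < c₀) (h₁ : c₀ ≤ c₁) (hΔ : 0 ≤ Δ) (D : Measure I)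
    [IsProbabilityMeasure D] {P : (Fin n → I) → (Fin m → Fin n → Bool) → Prop}
    (hP : MeasurableSet {ω : ((Fin n → I) × (Fin m → I)) × (Fin m → Fin n → Bool) |
      P ω.1.1 ω.2}) {δ : ℝ} (hδ : 0 ≤ δ)
    (h : ∀ x, ∑ b, (if P x b then prodWeight (rowWeight c₀ c₁ Δ D x) b else 0) ≤ δ) :
    (law c₀ c₁ Δ D n m).real {ω | P ω.1.1 ω.2} ≤ δ := by
  refine ENNReal.toReal_le_of_le_ofReal hδ ?_
  rw [law, Measure.compProd_apply hP, lintegral_prod _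
    (Kernel.measurable_kernel_prodMk_left hP).aemeasurable]
  have hx : ∀ x : Fin n → I, ∫⁻ y, (edgeKernel c₀ c₁ Δ n m (x, y))
      (Prod.mk (x, y) ⁻¹' {ω : ((Fin n → I) × (Fin m → I)) × (Fin m → Fin n → Bool) |
        P ω.1.1 ω.2}) ∂(Measure.pi fun _ => D) ≤ ENNReal.ofReal δ := by
    intro x
    refine (lintegral_edgeMeasure h₀ h₁ hΔ D x {b | P x b}).trans_le ?_
    exact ENNReal.ofReal_le_ofReal (h x)
  refine (lintegral_mono hx).trans_eq ?_
  simp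

lemma continuous_specNorm : Continuous (specNorm : Matrix (Fin n) (Fin n) ℝ → ℝ) := by
  unfold specNorm
  exact continuous_norm.comp (LinearMap.continuous_of_finiteDimensional
    (Matrix.toEuclideanCLM (n := Fin n) (𝕜 := ℝ)).toAlgEquiv.toLinearMap)

/-- There are finitely many edge configurations, and for each the norm is continuous in the
positions. -/
lemma measurable_specNorm_deviation (h₁ : 0 < c₁) (hΔ : 0 ≤ Δ) (D : Measure I)
    [IsProbabilityMeasure D] :
    Measurable fun ω : ((Fin n → I) × (Fin m → I)) × (Fin m → Fin n → Bool) =>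
      specNorm (((n : ℝ) / (m : ℝ)) • coMatrix ω.2 -
        (1 / (n : ℝ)) • gramMatrix c₀ c₁ Δ D ω.1.1) := by
  refine measurable_from_prod_countable_left fun b => ?_
  have hg : Continuous fun p : (Fin n → I) × (Fin m → I) => gramMatrix c₀ c₁ Δ D p.1 := by
    refine continuous_matrix fun i i' => ?_
    exact (continuous_sqKernel (c₀ := c₀) h₁ hΔ D).comp
      (f := fun p : (Fin n → I) × (Fin m → I) => (p.1 i, p.1 i')) (by fun_prop)
  have hd : Continuous fun p : (Fin n → I) × (Fin m → I) =>
      ((n : ℝ) / (m : ℝ)) • coMatrix b - (1 / (n : ℝ)) • gramMatrix c₀ c₁ Δ D p.1 :=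
    by fun_prop
  have hc : Continuous fun p : (Fin n → I) × (Fin m → I) =>
      specNorm (((n : ℝ) / (m : ℝ)) • coMatrix b - (1 / (n : ℝ)) • gramMatrix c₀ c₁ Δ D p.1) :=
    continuous_specNorm.comp hd
  exact hc.measurable

end Law

/-! ### Tail bound, choice of the moment order and conclusion. -/

/-- A finite-sample tail bound for the spectral norm of the deviation, through the trace moment
of order `2 * p`. -/
theorem law_real_deviation_gt_le {c₀ c₁ Δ : ℝ} (h₀ : 0 < c₀) (h₁ : c₀ ≤ c₁) (hΔ : 0 ≤ Δ)
    (D : Measure I) [IsProbabilityMeasure D] {n m : ℕ} (hn : 0 < n) (hnm : n ≤ m)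
    (hdiag : 1 / (n : ℝ) ≤ ((n : ℝ) / m) ^ (1 / 4 : ℝ)) {p : ℕ} (hp : p ≠ 0) :
    (law c₀ c₁ Δ D n m).real {ω | ¬ specNorm (((n : ℝ) / (m : ℝ)) • coMatrix ω.2 -
        (1 / (n : ℝ)) • gramMatrix c₀ c₁ Δ D ω.1.1) ≤ 2 * ((n : ℝ) / m) ^ (1 / 4 : ℝ)} ≤
      16 * n * (n + m) * (2048 * p ^ 5 * √((n : ℝ) / m)) ^ p := by
  have hm : 0 < m := hn.trans_le hnm
  have hn' : (0 : ℝ) < n := by exact_mod_cast hn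
  have hm' : (0 : ℝ) < m := by exact_mod_cast hm
  set l : ℝ := (n : ℝ) / m with hl
  have hl0 : 0 < l := by positivity
  set w : ℝ := l ^ (1 / 4 : ℝ) with hw
  have hw0 : 0 < w := Real.rpow_pos_of_pos hl0 _
  have hw2 : w ^ 2 = √l := by
    rw [hw, ← Real.rpow_natCast, ← Real.rpow_mul hl0.le, Real.sqrt_eq_rpow]
    norm_num
  have hml : (m : ℝ) / n = l⁻¹ := by rw [hl, inv_div]
  have hdec : {ω : ((Fin n → I) × (Fin m → I)) × (Fin m → Fin n → Bool) |
      ¬ specNorm (l • coMatrix ω.2 - (1 / (n : ℝ)) • gramMatrix c₀ c₁ Δ D ω.1.1) ≤ 2 * w} =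
      {ω | specNorm (l • coMatrix ω.2 - (1 / (n : ℝ)) • gramMatrix c₀ c₁ Δ D ω.1.1) ≤ 2 * w}ᶜ :=
    rfl
  refine law_real_le h₀ h₁ hΔ D (P := fun x b =>
    ¬ specNorm (l • coMatrix b - (1 / (n : ℝ)) • gramMatrix c₀ c₁ Δ D x) ≤ 2 * w)
    ?_ (by positivity) fun x => ?_
  · rw [hdec]
    exact (measurableSet_le (measurable_specNorm_deviation (h₀.trans_le h₁) hΔ D)
      measurable_const).compl
  have hq0 := rowWeight_nonneg (Δ := Δ) h₀ h₁ D x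
  have hR := sum_trace_rowGram_pow_le hn hnm hq0 (sum_rowWeight h₀ h₁ hΔ D x)
    (sum_rowWeight_exp_rowDegree_le h₀ h₁ hΔ D hn x)
    (fun i s hs0 hs1 => sum_rowWeight_exp_edgeVal_le h₀ h₁ hΔ D hn x i hs0 hs1)
    (meanGram_isSymm D x) (sum_rowWeight_smul_rowGram h₀ h₁ hΔ D x) hp
  -- The threshold `l⁻¹ * w` for the centred sum becomes `w` after scaling by `l = n/m`; the
  -- diagonal uses the other `w` of `2 * w`.
  have ht : 0 < l⁻¹ * w := by positivity
  refine (sum_prodWeight_specNorm_gt_le hp hq0 (meanGram_isSymm D x) ht hR _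
    fun b hb => ?_).trans_eq ?_
  · have h1 := specNorm_deviation_le (Δ := Δ) h₀ h₁ D hn hm x b
    rw [← hl] at h1
    rw [inv_mul_lt_iff₀ hl0]
    linarith [not_le.1 hb]
  · rw [pow_mul, mul_div_assoc, ← div_pow, mul_pow l⁻¹ w, hw2, hml]
    congr 2
    have hs : √l ≠ 0 := (Real.sqrt_pos.2 hl0).ne'
    have : l⁻¹ / ((l⁻¹) ^ 2 * √l) = √l := by
      rw [div_eq_iff (by positivity)]
      field_simp
      rw [Real.sq_sqrt hl0.le]
    rw [mul_div_assoc, this]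

lemma natCeil_log_bounds {n : ℕ} (h : 1 ≤ Real.log n) :
    ⌈Real.log n⌉₊ ≠ 0 ∧ Real.log n ≤ (⌈Real.log n⌉₊ : ℝ) ∧
      (⌈Real.log n⌉₊ : ℝ) ≤ 2 * Real.log n := by
  have h0 : 0 ≤ Real.log n := by linarith
  refine ⟨(Nat.ceil_pos.2 (by linarith)).ne', Nat.le_ceil _, ?_⟩
  linarith [Nat.ceil_lt_add_one h0]

/-- The tail bound of order `⌈log n⌉` is smaller than any power of `n` once `n / m` is at most a
constant over `(log n) ^ 12` and `n` is large. -/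
lemma tail_lt_rpow {n m : ℕ} {a K : ℝ} (hn : 6 ≤ n) (hm : 0 < m) (hmn : (m : ℝ) ≤ (n : ℝ) ^ 2)
    (hlog : 1 ≤ Real.log n) (hr : (n : ℝ) / m ≤ K / Real.log n ^ 12)
    (hbig : 65536 * √K * Real.exp (|a| + 5) ≤ Real.log n) :
    16 * n * (n + m) * (2048 * (⌈Real.log n⌉₊ : ℝ) ^ 5 * √((n : ℝ) / m)) ^ ⌈Real.log n⌉₊ <
      (n : ℝ) ^ (-a) := by
  have hn' : (6 : ℝ) ≤ n := by exact_mod_cast hn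
  have hn0 : (0 : ℝ) < n := by linarith
  obtain ⟨-, hp1, hp2⟩ := natCeil_log_bounds hlog
  set ℓ := Real.log n with hℓ
  set p := ⌈ℓ⌉₊ with hp
  have hℓ0 : 0 < ℓ := by linarith
  have hsq : √((n : ℝ) / m) ≤ √K / ℓ ^ 6 := by
    refine (Real.sqrt_le_sqrt hr).trans_eq ?_
    rw [Real.sqrt_div' _ (by positivity), show ℓ ^ 12 = (ℓ ^ 6) ^ 2 by ring,
      Real.sqrt_sq (by positivity)]
  -- With `p ≤ 2ℓ` the factor `p⁵` costs `32 ℓ⁵` against `ℓ⁶` from the square root; `65536 = 2048 ·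
  -- 32`.
  have hbase : 2048 * (p : ℝ) ^ 5 * √((n : ℝ) / m) ≤ Real.exp (-(|a| + 5)) := by
    calc 2048 * (p : ℝ) ^ 5 * √((n : ℝ) / m) ≤ 2048 * (2 * ℓ) ^ 5 * (√K / ℓ ^ 6) := by gcongr
      _ = 65536 * √K / ℓ := by field_simp; ring
      _ ≤ Real.exp (-(|a| + 5)) := by
        rw [div_le_iff₀ hℓ0, Real.exp_neg, ← div_eq_inv_mul, le_div_iff₀ (Real.exp_pos _)]
        exact hbig
  have hpow : (2048 * (p : ℝ) ^ 5 * √((n : ℝ) / m)) ^ p ≤ (n : ℝ) ^ (-(|a| + 5)) := by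
    calc (2048 * (p : ℝ) ^ 5 * √((n : ℝ) / m)) ^ p ≤ Real.exp (-(|a| + 5)) ^ p :=
          pow_le_pow_left₀ (by positivity) hbase p
      _ = Real.exp (p * -(|a| + 5)) := by rw [Real.exp_nat_mul]
      _ ≤ Real.exp (ℓ * -(|a| + 5)) := by
          refine Real.exp_le_exp.2 ?_
          nlinarith [abs_nonneg a]
      _ = _ := by rw [Real.rpow_def_of_pos hn0]
  have hsplit : (n : ℝ) ^ (-(|a| + 5)) = (n : ℝ) ^ (-|a|) * ((n : ℝ) ^ 5)⁻¹ := by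
    rw [neg_add, Real.rpow_add hn0, Real.rpow_neg hn0.le 5]
    norm_cast
  have ha : (n : ℝ) ^ (-|a|) ≤ (n : ℝ) ^ (-a) :=
    Real.rpow_le_rpow_of_exponent_le (by linarith) (neg_le_neg (le_abs_self a))
  have hpos : 0 < (n : ℝ) ^ (-|a|) := Real.rpow_pos_of_pos hn0 _
  refine lt_of_lt_of_le ?_ ha
  -- As `m ≤ n²`, the prefactor is at most `32 n³`. The spare `n⁻⁵` leaves `32 / n²`, which is below
  -- `1` from `n = 6` on.
  calc 16 * n * (n + m) * (2048 * (p : ℝ) ^ 5 * √((n : ℝ) / m)) ^ p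
      ≤ 16 * n * (n ^ 2 + n ^ 2) * ((n : ℝ) ^ (-|a|) * ((n : ℝ) ^ 5)⁻¹) := by
        rw [← hsplit]
        gcongr
        nlinarith
    _ = (n : ℝ) ^ (-|a|) * (32 / n ^ 2) := by field_simp; ring
    _ < (n : ℝ) ^ (-|a|) * 1 := by
        refine mul_lt_mul_of_pos_left ?_ hpos
        rw [div_lt_one (by positivity)]
        nlinarith
    _ = _ := mul_one _

lemma one_div_le_rpow_quarter {n m : ℕ} (hn : 0 < n) (hm : 0 < m)
    (hmn : (m : ℝ) ≤ (n : ℝ) ^ 2) : 1 / (n : ℝ) ≤ ((n : ℝ) / m) ^ (1 / 4 : ℝ) := by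
  have hn' : (1 : ℝ) ≤ n := by exact_mod_cast hn
  have hm' : (0 : ℝ) < m := by exact_mod_cast hm
  have h1 : 1 / (n : ℝ) ≤ (n : ℝ) / m := by
    rw [div_le_div_iff₀ (by linarith) hm']
    nlinarith
  have h2 : 1 / (n : ℝ) ≤ 1 := by rw [div_le_one (by linarith)]; exact hn'
  have h3 : 0 < 1 / (n : ℝ) := by positivity
  calc 1 / (n : ℝ) = (1 / (n : ℝ)) ^ (1 : ℝ) := (Real.rpow_one _).symm
    _ ≤ (1 / (n : ℝ)) ^ (1 / 4 : ℝ) := Real.rpow_le_rpow_of_exponent_ge h3 h2 (by norm_num)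
    _ ≤ _ := Real.rpow_le_rpow h3.le h1 (by norm_num)

lemma eventually_le_sq {m : ℕ → ℕ} {k : ℝ} (h : (fun n : ℕ => (m n : ℝ)) =O[Filter.atTop]
    fun n : ℕ => (n : ℝ) * Real.log n ^ k) :
    ∀ᶠ n : ℕ in Filter.atTop, (m n : ℝ) ≤ (n : ℝ) ^ 2 := by
  have h1 : (fun n : ℕ => Real.log n ^ k) =o[Filter.atTop] fun n : ℕ => (n : ℝ) := by
    have := (isLittleO_log_rpow_rpow_atTop k one_pos).comp_tendsto tendsto_natCast_atTop_atTop
    simpa [Function.comp_def] using this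
  have h2 : (fun n : ℕ => (m n : ℝ)) =o[Filter.atTop] fun n : ℕ => (n : ℝ) * n :=
    h.trans_isLittleO ((Asymptotics.isBigO_refl (fun n : ℕ => (n : ℝ)) _).mul_isLittleO h1)
  filter_upwards [h2.bound one_pos] with n hn
  rw [Real.norm_of_nonneg (by positivity), Real.norm_of_nonneg (by positivity), one_mul] at hn
  rwa [pow_two]

end BipartiteModel

open BipartiteModel in
theorem mainTheorem7 :
    ∃ c' : ℝ, 0 < c' ∧
      ∀ (c₀ c₁ Δ : ℝ), 0 < c₀ → c₀ ≤ c₁ → 1 < Δ →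
      ∀ (D : Measure unitInterval) [IsProbabilityMeasure D],
      ∃ C : ℝ, 0 < C ∧
        ∀ (c : ℝ), c' ≤ c → ∀ (m : ℕ → ℕ),
          ((fun n : ℕ => (n : ℝ) * Real.log n ^ c) =O[Filter.atTop] fun n : ℕ => (m n : ℝ)) →
          (∃ k : ℝ, (fun n : ℕ => (m n : ℝ)) =O[Filter.atTop]
            fun n : ℕ => (n : ℝ) * Real.log n ^ k) →
          ∀ a : ℝ, ∀ᶠ n : ℕ in Filter.atTop,
            1 - (n : ℝ) ^ (-a) <
              (BipartiteModel.law c₀ c₁ Δ D n (m n)).real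
                {ω | BipartiteModel.specNorm
                    (((n : ℝ) / (m n : ℝ)) • BipartiteModel.coMatrix ω.2 -
                      (1 / (n : ℝ)) • BipartiteModel.gramMatrix c₀ c₁ Δ D ω.1.1)
                  ≤ C * ((n : ℝ) / (m n : ℝ)) ^ (1 / 4 : ℝ)} := by
  -- The exponent `12` makes `√(n/m)` of order at most `(log n)⁻⁶`, beating `p⁵`. The constant `2`
  -- allows one `(n/m)^(1/4)` for the fluctuation and one for the diagonal.
  refine ⟨12, by norm_num, fun c₀ c₁ Δ h₀ h₁ hΔ D _ => ⟨2, by norm_num, ?_⟩⟩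
  intro c hc m hlow hup a
  obtain ⟨k, hk⟩ := hup
  obtain ⟨K, hK, hlow⟩ := hlow.exists_pos
  have hlog : Filter.Tendsto (fun n : ℕ => Real.log n) Filter.atTop Filter.atTop :=
    Real.tendsto_log_atTop.comp tendsto_natCast_atTop_atTop
  have hΔ0 : 0 ≤ Δ := by linarith
  filter_upwards [hlow.bound, eventually_le_sq hk, Filter.eventually_ge_atTop 6,
    hlog.eventually_ge_atTop 1, hlog.eventually_ge_atTop K,
    hlog.eventually_ge_atTop (65536 * √K * Real.exp (|a| + 5))]
    with n hKm hmsq hn6 hl1 hlK hlbig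
  have hn : 0 < n := by omega
  have hn' : (0 : ℝ) < n := by exact_mod_cast hn
  have hl0 : 0 < Real.log n := by linarith
  have hpow12 : Real.log n ^ 12 ≤ Real.log n ^ c := by
    rw [← Real.rpow_natCast]
    exact Real.rpow_le_rpow_of_exponent_le hl1 (by exact_mod_cast hc)
  rw [Real.norm_of_nonneg (by positivity), Real.norm_of_nonneg (by positivity)] at hKm
  have hlow12 : (n : ℝ) * Real.log n ^ 12 ≤ K * m n :=
    (mul_le_mul_of_nonneg_left hpow12 hn'.le).trans hKm
  have hm' : (0 : ℝ) < m n := by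
    have : 0 < K * (m n : ℝ) := lt_of_lt_of_le (by positivity) hlow12
    exact pos_of_mul_pos_right this hK.le
  have hm : 0 < m n := by exact_mod_cast hm'
  have hr : (n : ℝ) / m n ≤ K / Real.log n ^ 12 := by
    rw [div_le_div_iff₀ hm' (by positivity)]
    exact hlow12
  have hnm : n ≤ m n := by
    have h1 : K ≤ Real.log n ^ 12 := hlK.trans (le_self_pow₀ hl1 (by norm_num))
    have h2 : (n : ℝ) / m n ≤ 1 := hr.trans (div_le_one_of_le₀ h1 (by positivity))
    rw [div_le_one hm'] at h2
    exact_mod_cast h2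
  have htail := (law_real_deviation_gt_le h₀ h₁ hΔ0 D hn hnm
    (one_div_le_rpow_quarter hn hm hmsq) (natCeil_log_bounds hl1).1).trans_lt
    (tail_lt_rpow (a := a) hn6 hm hmsq hl1 hr hlbig)
  have hmeas : MeasurableSet {ω : ((Fin n → I) × (Fin (m n) → I)) × (Fin (m n) → Fin n → Bool) |
      specNorm (((n : ℝ) / (m n : ℝ)) • coMatrix ω.2 -
        (1 / (n : ℝ)) • gramMatrix c₀ c₁ Δ D ω.1.1) ≤
          2 * ((n : ℝ) / (m n : ℝ)) ^ (1 / 4 : ℝ)} :=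
    measurableSet_le (measurable_specNorm_deviation (h₀.trans_le h₁) hΔ0 D) measurable_const
  have hcompl := probReal_compl_eq_one_sub (μ := law c₀ c₁ Δ D n (m n)) hmeas
  rw [Set.compl_ofPred] at hcompl
  linarith
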